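/- **Setting.** Let $M$ be a non-empty finite set of agents (write $|M|$ for its size), $\theta^*\in\mathbb R^d$, and let $X\subset\mathbb R^d$ be a non-empty finite action set with $K=|X|$ that is available to every agent at every time-step. An agent that plays $x\in X$ at a time-step observes $\langle\theta^*,x\rangle+\eta$, where the noise variables $\eta$ of all agents and time-steps are i.i.d., zero-mean and sub-Gaussian. Put $D=\max_{x,x'\in X}\langle\theta^*,x-x'\rangle$, the largest per-step regret (if per-step regrets are at most $1$, then $D\le 1$). A single-agent algorithm $\textsc{Sin}$ on $X$ is a possibly randomized rule that chooses the next action in $X$ from the history of its actions and rewards. Let $R(t)$ be its expected pseudo-regret over $t$ steps on this instance, i.e. $R(t)=\sum_{s\le t}\big(\max_{x\in X}\langle\theta^*,x\rangle-\mathbb E\langle\theta^*,x_s\rangle\big)$, and for integers $t,g,h\ge1$ put $$R'(t,h)=\frac{R(t+h)-R(t)}{h},\qquad R''(t,g,h)=\frac{R'(t+g,h)-R'(t,h)}{g}.$$ A coalition $C\subseteq M$ runs the meta-algorithm $\textsc{Mul}$: it keeps a reward buffer $B_x$ for each $x\in X$, all initially empty, and a simulated history, initially empty. At each time-step $1,\dots,T$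 every agent of $C$ plays the action $\bar x$ that $\textsc{Sin}$ requests on the simulated history, and the $|C|$ observed rewards are put into $B_{\bar x}$. Then, as long as the buffer $B_{\bar x}$ of the currently requested action $\bar x$ is non-empty, one reward $\bar y$ is removed from it, $(\bar x,\bar y)$ is appended to the simulated history, and $\textsc{Sin}$ is asked for the next action. The reward to be removed is chosen by any rule that may depend on the simulated history, but does not look at rewards that have not been removed yet. Let $R^C_a$ be the expected pseudo-regret of agent $a\in C$ over the $T$ time-steps, and $v_T(C)=-\sum_{a\in C}R^C_a$. The game $(M,v_T)$ is *convex* if $v_T(S\cup\{a\})-v_T(S)\le v_T(Q\cup\{a\})-v_T(Q)$ for all $S\subseteq Q\subseteq M\setminus\{a\}$. **Theorem.** 1. Let $T\ge 1$ be a horizon for which there are numbers $\upsilon_t>0$ ($1\le t\le |M|T$) and constants $c,\varepsilon>0$ with $$-c\,t^{-2+\varepsilon}\;\le\;R''(t,g,h)\;\le\;-\upsilon_t\qquad\text{for all integers }t,g,h\ge1\text{ with }t+g+h\le |M|T .$$ If $T$ is large enough in the sense that $T\ge\sqrt{4|M|KD/\min_{1\le t\le |M|T}\upsilon_t}$, then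 the game $(M,v_T)$ is convex. 2. In particular, suppose that for some $c>0$ and $0<\varepsilon<2$ one has $R''(t,g,h)\le -c\,(t+g+h)^{-2+\varepsilon}$ for all integers $t,g,h\ge1$. Then $(M,v_T)$ is convex for all sufficiently large $T$, namely for every $T\ge\big(4KD\,|M|^{3-\varepsilon}/c\big)^{1/\varepsilon}$. -/

import Mathlib

open MeasureTheory ProbabilityTheory

/-! ## Bandit instances -/

/-- The ambient Euclidean space of actions and parameters. -/
abbrev Act (d : ℕ) : Type := EuclideanSpace ℝ (Fin d)

/-- A multi-agent linear bandit instance with agents `ι`: the unknown parameter `θ*`, the action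
sets `X_{a,t}` (the index `t : ℕ` stands for the time-step `t + 1`), and the common law of the
i.i.d. zero-mean sub-Gaussian reward noise. -/
structure BanditInstance (d : ℕ) (ι : Type*) where
  theta : Act d
  actions : ι → ℕ → Set (Act d)
  noise : Measure ℝ
  noise_prob : IsProbabilityMeasure noise
  noise_mean : ∫ z, z ∂noise = 0
  noise_subgaussian : ∃ σ, HasSubgaussianMGF id σ noise

/-- All agents have the same finite action set `X` at all time-steps. -/
def BanditInstance.IsFixed {d : ℕ} {ι : Type*} (I : BanditInstance d ι) (X : Finset (Act d)) :
    Prop :=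
  ∀ a t, I.actions a t = (X : Set (Act d))

/-- The instance as seen by the members of a coalition. -/
def BanditInstance.restrict {d : ℕ} {A : Type*} (I : BanditInstance d A) (C : Finset A) :
    BanditInstance d C where
  theta := I.theta
  actions := fun a t => I.actions a t
  noise := I.noise
  noise_prob := I.noise_prob
  noise_mean := I.noise_mean
  noise_subgaussian := I.noise_subgaussian

/-! ## Algorithms, histories and regret -/

/-- A multi-agent algorithm for the agents `ι` with internal randomness in `Ω`: from the internal
randomness and the joint history (oldest entry first) it produces the action of every agent. -/
abbrev MultiAlg (d : ℕ) (ι : Type*) (Ω : Type*) :=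
  Ω → List (ι → Act d × ℝ) → ι → Act d

/-- The joint history after `t` time-steps when the internal randomness is `w` and the noise
variables are `η`: agent `a` plays `x` and observes `⟨θ*, x⟩ + η_{a,t}`. -/
noncomputable def BanditInstance.history {d : ℕ} {ι Ω : Type*} (I : BanditInstance d ι)
    (alg : MultiAlg d ι Ω) (w : Ω) (η : ι × ℕ → ℝ) : ℕ → List (ι → Act d × ℝ)
  | 0 => []
  | t + 1 => I.history alg w η t ++
      [fun a => (alg w (I.history alg w η t) a,
        inner ℝ I.theta (alg w (I.history alg w η t) a) + η (a, t))]

/-- Expected pseudo-regret of agent `a` over `T` time-steps, the expectation being over the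
internal randomness of the algorithm (law `P`) and the independent i.i.d. noise variables. -/
noncomputable def BanditInstance.regret {d : ℕ} {ι Ω : Type*} [MeasurableSpace Ω]
    (I : BanditInstance d ι) (P : Measure Ω) (alg : MultiAlg d ι Ω) (T : ℕ) (a : ι) : ℝ :=
  ∑ t ∈ Finset.range T,
    (sSup ((fun x => inner ℝ I.theta x) '' I.actions a t) -
      ∫ ω : Ω × (ι × ℕ → ℝ), inner ℝ I.theta (alg ω.1 (I.history alg ω.1 ω.2 t) a)
        ∂(P.prod (Measure.infinitePi fun _ : ι × ℕ => I.noise)))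

/-- The collaboration game `v(C) = - ∑_{a ∈ C} R^C_a`, every coalition running its own copy of the
algorithm and seeing only its own histories. -/
noncomputable def BanditInstance.value {d : ℕ} {A Ω : Type*} [MeasurableSpace Ω]
    (I : BanditInstance d A) (P : Measure Ω) (alg : ∀ C : Finset A, MultiAlg d C Ω) (T : ℕ)
    (C : Finset A) : ℝ :=
  - ∑ a : C, (I.restrict C).regret P (alg C) T a

/-- Convexity (supermodularity) of a TU game. -/
def IsConvexGame {A : Type*} [DecidableEq A] (v : Finset A → ℝ) : Prop :=
  ∀ (i : A) (C D : Finset A), C ⊆ D → i ∉ D → v (insert i C) - v C ≤ v (insert i D) - v D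

/-- A (possibly randomized) single-agent algorithm on the action set `X`: a measurable
function of the internal randomness and of the action-reward history (oldest entry first). -/
structure SingleAlg (d : ℕ) (X : Finset (Act d)) (Ω : Type*) [MeasurableSpace Ω] where
  act : Ω → List (Act d × ℝ) → Act d
  act_mem : ∀ w h, act w h ∈ X
  measurable_act : ∀ n : ℕ,
    Measurable fun p : Ω × (Fin n → Act d × ℝ) => act p.1 (List.ofFn p.2)

/-- `R_a(Sin, I, T)`: the regret of agent `a` when it forms a singleton coalition and runs the
single-agent algorithm. -/
noncomputable def BanditInstance.singleRegret {d : ℕ} {A Ω : Type*} [MeasurableSpace Ω]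
    (I : BanditInstance d A) (P : Measure Ω) {X : Finset (Act d)} (S : SingleAlg d X Ω) (a : A)
    (T : ℕ) : ℝ :=
  (I.restrict {a}).regret P
    (fun w H _ => S.act w (H.map fun p => p ⟨a, Finset.mem_singleton_self a⟩)) T
    ⟨a, Finset.mem_singleton_self a⟩

/-! ## The buffer-based multi-agent meta-algorithm -/

/-- The rule by which one of the rewards left in a buffer is removed. The rule is
arbitrary, except that it cannot look at rewards which have not been read yet: given the
simulated history, the requested action and the set of agents whose latest reward for that action
is still in the buffer, it names one of these agents. -/
structure RemovalRule (d : ℕ) (ι : Type*) where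
  pick : List (Act d × ℝ) → Act d → (B : Finset ι) → B.Nonempty → ι
  pick_mem : ∀ h x B hB, pick h x B hB ∈ B
  measurable_pick : ∀ (n : ℕ) (x : Act d) (B : Finset ι) (hB : B.Nonempty) (b : ι),
    MeasurableSet {h : Fin n → Act d × ℝ | pick (List.ofFn h) x B hB = b}

/-- State of the meta-algorithm: the simulated single-agent history, and for every action `x` the
buffer `B_x = {val x b : b ∈ avail x}` (as a multiset of rewards labelled by agents). -/
structure MulState (d : ℕ) (ι : Type*) where
  hist : List (Act d × ℝ)
  avail : Act d → Finset ι
  val : Act d → ι → ℝ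

section Mul

variable {d : ℕ} {ι Ω : Type*} {X : Finset (Act d)} [MeasurableSpace Ω]

/-- The action that the single-agent algorithm requests next. -/
def MulState.next (S : SingleAlg d X Ω) (w : Ω) (s : MulState d ι) : Act d := S.act w s.hist

open Classical in
/-- One pass through the `while` loop: if the buffer of the requested action is non-empty, remove
a reward from it and append it to the simulated history; otherwise do nothing. -/
noncomputable def MulState.read (S : SingleAlg d X Ω) (ρ : RemovalRule d ι) (w : Ω)
    (s : MulState d ι) : MulState d ι :=
  let x := s.next S w
  if hB : (s.avail x).Nonempty then
    let b := ρ.pick s.hist x (s.avail x) hB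
    { hist := s.hist ++ [(x, s.val x b)]
      avail := Function.update s.avail x ((s.avail x).erase b)
      val := s.val }
  else s

/-- The total number of rewards in the buffers. -/
def MulState.size (X : Finset (Act d)) (s : MulState d ι) : ℕ := ∑ x ∈ X, (s.avail x).card

/-- The whole `while` loop. Every effective pass removes one reward, so `size` many passes are
enough (`MulState.drain_exit`). -/
noncomputable def MulState.drain (S : SingleAlg d X Ω) (ρ : RemovalRule d ι) (w : Ω)
    (s : MulState d ι) : MulState d ι :=
  (MulState.read S ρ w)^[s.size X] s

open Classical in
/-- One time-step: all agents have played the requested action, with outcomes `p`; the buffer of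
that action is filled with the rewards of all agents and then the `while` loop is run. -/
noncomputable def MulState.round [Fintype ι] (S : SingleAlg d X Ω) (ρ : RemovalRule d ι) (w : Ω)
    (s : MulState d ι) (p : ι → Act d × ℝ) : MulState d ι :=
  MulState.drain S ρ w
    { hist := s.hist
      avail := Function.update s.avail (s.next S w) Finset.univ
      val := Function.update s.val (s.next S w) fun b => (p b).2 }

/-- The meta-algorithm `Mul` built on the single-agent algorithm `S`: it starts with empty buffers
and an empty simulated history, and at each time-step every agent plays the requested action. -/
noncomputable def mul [Fintype ι] (S : SingleAlg d X Ω) (ρ : RemovalRule d ι) :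
    MultiAlg d ι Ω :=
  fun w H _ => (H.foldl (MulState.round S ρ w) ⟨[], fun _ => ∅, fun _ _ => 0⟩).next S w

theorem MulState.read_of_empty (S : SingleAlg d X Ω) (ρ : RemovalRule d ι) (w : Ω)
    (s : MulState d ι) (h : s.avail (s.next S w) = ∅) : s.read S ρ w = s := by
  simp [MulState.read, h]

theorem MulState.size_read (S : SingleAlg d X Ω) (ρ : RemovalRule d ι) (w : Ω)
    (s : MulState d ι) (h : (s.avail (s.next S w)).Nonempty) :
    (s.read S ρ w).size X < s.size X := by
  classical
  unfold MulState.size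
  apply Finset.sum_lt_sum
  · intro x _
    by_cases hx : x = s.next S w
    · subst hx
      simp only [MulState.read, h, dite_true, Function.update_self]
      exact Finset.card_le_card (Finset.erase_subset _ _)
    · simp [MulState.read, h, Function.update_of_ne hx]
  · refine ⟨s.next S w, S.act_mem w s.hist, ?_⟩
    simp only [MulState.read, h, dite_true, Function.update_self]
    exact Finset.card_erase_lt_of_mem (ρ.pick_mem _ _ _ _)

/-- When the loop ends, its guard is false: the buffer of the requested action is empty. -/
theorem MulState.drain_exit (S : SingleAlg d X Ω) (ρ : RemovalRule d ι) (w : Ω)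
    (s : MulState d ι) :
    (s.drain S ρ w).avail ((s.drain S ρ w).next S w) = ∅ := by
  suffices H : ∀ (n : ℕ) (s : MulState d ι), s.size X ≤ n →
      ((MulState.read S ρ w)^[n] s).avail (((MulState.read S ρ w)^[n] s).next S w) = ∅ from
    H _ s le_rfl
  intro n
  induction n with
  | zero =>
    intro s hs
    by_contra hne
    have := MulState.size_read S ρ w s (Finset.nonempty_iff_ne_empty.mpr hne)
    omega
  | succ n ih =>
    intro s hs
    rw [Function.iterate_succ_apply]
    by_cases h : (s.avail (s.next S w)).Nonempty
    · exact ih _ (by have := MulState.size_read S ρ w s h; omega)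
    · have h' := Finset.not_nonempty_iff_eq_empty.mp h
      have hfix := MulState.read_of_empty S ρ w s h'
      rw [hfix, Function.iterate_fixed hfix]
      exact h'

end Mul

/-! ## Assumption on the regret curve -/

/-- Discrete first derivative `R'(t,h)`. -/
noncomputable def discDeriv (R : ℕ → ℝ) (t h : ℕ) : ℝ := (R (t + h) - R t) / h

/-- Discrete second derivative `R''(t,g,h)`. -/
noncomputable def discDeriv2 (R : ℕ → ℝ) (t g h : ℕ) : ℝ :=
  (discDeriv R (t + g) h - discDeriv R t h) / g

/-- Strict concavity (with margins `υ t`) and logarithmic limitation (with constants `c, ε`) of the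
regret curve `R` on the times `1, …, N`. -/
structure RegretRate (R : ℕ → ℝ) (N : ℕ) (υ : ℕ → ℝ) (c ε : ℝ) : Prop where
  margin_pos : ∀ t, 1 ≤ t → t ≤ N → 0 < υ t
  strict_concave : ∀ t g h, 1 ≤ t → 1 ≤ g → 1 ≤ h → t + g + h ≤ N →
    discDeriv2 R t g h ≤ -υ t
  log_limit : ∀ t g h, 1 ≤ t → 1 ≤ g → 1 ≤ h → t + g + h ≤ N →
    -(c * (t : ℝ) ^ (-2 + ε)) ≤ discDeriv2 R t g h

/-- The largest expected regret that one play of an action in `X` can incur. -/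
noncomputable def maxGap {d : ℕ} (θ : Act d) (X : Finset (Act d)) : ℝ :=
  sSup ((fun x => inner ℝ θ x) '' (X : Set (Act d))) -
    sInf ((fun x => inner ℝ θ x) '' (X : Set (Act d)))

/-!
The order in which the meta-algorithm removes rewards is determined by the simulated history, and it
never reads the same noise variable twice. The next noise variable is therefore a fresh sample even
though its index is random, and the simulated history has the law of the history of the single-agent
algorithm playing alone. A buffer is refilled only when it is empty, so it holds at most `|C| - 1`
rewards between time-steps, and the `|C| T` plays of the coalition are the first `|C| T` plays of
the simulated algorithm except for the at most `(|C| - 1) K` buffered ones. Each of these costs at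
most `D`, hence `v(C) = -R(|C| T)` up to `(|C| - 1) K D`.

The marginal contribution of a player to `C` is thus close to `-(R((|C| + 1) T) - R(|C| T))`, which
grows with `|C|` because `R` is concave; on blocks of length `T` the strict concavity contributes
`υ T ^ 2 ≥ 4 |M| K D`, which absorbs all errors. For `C = ∅` the block starts at time `0`, where
nothing is assumed about `R`; its first step is given up, at the price of another `D`. If `T = 1`,
every agent plays the first request of the single-agent algorithm and the game is additive.
-/

section MeasurableList

variable {Ω E β : Type*} [MeasurableSpace Ω] [MeasurableSpace E] [MeasurableSpace β]

/-- The σ-algebra of finite sequences: a set of lists is measurable if its members of each length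
`n` form a measurable subset of `Fin n → E`. -/
instance instMeasurableSpaceFiniteSequence : MeasurableSpace (List E) :=
  ⨅ n, MeasurableSpace.map (List.ofFn : (Fin n → E) → List E) inferInstance

theorem measurableSet_list_iff {s : Set (List E)} :
    MeasurableSet s ↔ ∀ n, MeasurableSet ((List.ofFn : (Fin n → E) → List E) ⁻¹' s) :=
  MeasurableSpace.measurableSet_iInf

theorem measurableEmbedding_ofFn (n : ℕ) :
    MeasurableEmbedding (List.ofFn : (Fin n → E) → List E) where
  injective := List.ofFn_injective
  measurable _ hs := measurableSet_list_iff.mp hs n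
  measurableSet_image' s hs := by
    refine measurableSet_list_iff.mpr fun m => ?_
    by_cases hmn : m = n
    · subst hmn
      rwa [Set.preimage_image_eq s List.ofFn_injective]
    · convert! MeasurableSet.empty
      refine Set.eq_empty_of_forall_notMem ?_
      rintro v ⟨u, -, huv⟩
      exact hmn (by simpa using (congrArg List.length huv).symm)

theorem measurable_of_comp_prodMap_ofFn {f : Ω × List E → β}
    (hf : ∀ n, Measurable fun p : Ω × (Fin n → E) => f (p.1, List.ofFn p.2)) :
    Measurable f := by
  intro s hs
  have hpieces : f ⁻¹' s = ⋃ n, Prod.map id (List.ofFn : (Fin n → E) → List E) ''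
      ((fun p => f (p.1, List.ofFn p.2)) ⁻¹' s) := by
    ext ⟨w, h⟩
    simp only [Set.mem_preimage, Set.mem_iUnion, Set.mem_image, Prod.exists, Prod.map_apply, id_eq,
      Prod.mk.injEq]
    constructor
    · intro hwh
      exact ⟨h.length, w, h.get, by simpa using hwh, rfl, List.ofFn_get h⟩
    · rintro ⟨n, w, v, hv, rfl, rfl⟩
      exact hv
  rw [hpieces]
  exact MeasurableSet.iUnion fun n =>
    (MeasurableEmbedding.id.prodMap (measurableEmbedding_ofFn n)).measurableSet_image' (hf n hs)

theorem measurable_append_singleton : Measurable fun p : E × List E => p.2 ++ [p.1] := by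
  refine measurable_of_comp_prodMap_ofFn fun n => ?_
  have hsnoc : Measurable fun p : E × (Fin n → E) => (Fin.snoc p.2 p.1 : Fin (n + 1) → E) := by
    refine measurable_pi_lambda _ fun i => ?_
    induction i using Fin.lastCases with
    | last => simpa only [Fin.snoc_last] using measurable_fst
    | cast i =>
      simp only [Fin.snoc_castSucc]
      exact (measurable_pi_apply i).comp measurable_snd
  convert! (measurableEmbedding_ofFn (n + 1)).measurable.comp hsnoc using 2 with p
  simp only [Function.comp_apply, List.ofFn_succ_last, Fin.snoc_castSucc, Fin.snoc_last]

end MeasurableList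

section Resampling

variable {κ : Type*}

theorem measure_eq_tsum_inter_preimage {α : Type*} [MeasurableSpace α] [Countable κ]
    [MeasurableSpace κ] [MeasurableSingletonClass κ] (μ : Measure α) {f : α → κ} (hf : Measurable f)
    {s : Set α} (hs : MeasurableSet s) : μ s = ∑' i, μ (s ∩ f ⁻¹' {i}) := by
  have hpieces : s = ⋃ i, s ∩ f ⁻¹' {i} := by
    rw [← Set.inter_iUnion, ← Set.preimage_iUnion, Set.iUnion_of_singleton, Set.preimage_univ,
      Set.inter_univ]
  conv_lhs => rw [hpieces]
  refine measure_iUnion (fun i j hij => ?_) fun i => hs.inter (hf (measurableSet_singleton i))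
  exact (Disjoint.preimage f (Set.disjoint_singleton.mpr hij)).mono
    Set.inter_subset_right Set.inter_subset_right

theorem measurable_apply_index {Z : Type*} [MeasurableSpace Z] [Countable κ] [MeasurableSpace κ]
    [MeasurableSingletonClass κ] : Measurable fun q : (κ → Z) × κ => q.1 q.2 :=
  measurable_from_prod_countable_left measurable_pi_apply

variable [DecidableEq κ]

theorem measurePreserving_update_infinitePi {Z : κ → Type*} [∀ i, MeasurableSpace (Z i)]
    (ν : ∀ i, Measure (Z i)) [∀ i, IsProbabilityMeasure (ν i)] (k : κ) :
    MeasurePreserving (fun p : (∀ i, Z i) × Z k => Function.update p.1 k p.2)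
      ((Measure.infinitePi ν).prod (ν k)) (Measure.infinitePi ν) := by
  refine ⟨measurable_update', Measure.eq_infinitePi _ fun s t ht => ?_⟩
  rw [Measure.map_apply measurable_update' (.pi s.countable_toSet fun i _ => ht i)]
  have hpre : (fun p : (∀ i, Z i) × Z k => Function.update p.1 k p.2) ⁻¹' Set.pi (s : Set κ) t =
      Set.pi ((s.erase k : Finset κ) : Set κ) t ×ˢ (if k ∈ s then t k else Set.univ) := by
    ext ⟨η, z⟩
    simp only [Set.mem_preimage, Set.mem_pi, Finset.mem_coe, Set.mem_prod, Finset.mem_erase]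
    constructor
    · intro h
      refine ⟨fun i hi => by simpa [Function.update_of_ne hi.1] using h i hi.2, ?_⟩
      split_ifs with hk
      · simpa using h k hk
      · trivial
    · rintro ⟨hη, hz⟩ i hi
      obtain rfl | hik := eq_or_ne i k
      · simpa [hi] using hz
      · simpa [Function.update_of_ne hik] using hη i ⟨hik, hi⟩
  rw [hpre, Measure.prod_prod, Measure.infinitePi_pi ν fun i _ => ht i]
  split_ifs with hk
  · exact Finset.prod_erase_mul s _ hk
  · simp [Finset.erase_eq_of_notMem hk]

variable {Ω Z : Type*} [MeasurableSpace Ω] [MeasurableSpace Z] [Countable κ] [MeasurableSpace κ]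
  [MeasurableSingletonClass κ] {P : Measure Ω} [SFinite P] {ν : Measure Z} [IsProbabilityMeasure ν]

/-- A coordinate may be chosen at random and resampled, as long as its current value does not
influence the choice. -/
theorem measurePreserving_update_randomIndex {k : Ω × (κ → Z) → κ} (hk : Measurable k)
    (hk_update : ∀ w η z, k (w, Function.update η (k (w, η)) z) = k (w, η)) :
    MeasurePreserving (fun q : (Ω × (κ → Z)) × Z => (q.1.1, Function.update q.1.2 (k q.1) q.2))
      ((P.prod (Measure.infinitePi fun _ => ν)).prod ν)
      (P.prod (Measure.infinitePi fun _ => ν)) := by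
  set μ := Measure.infinitePi fun _ : κ => ν
  let Φ (i : κ) (q : (Ω × (κ → Z)) × Z) : Ω × (κ → Z) := (q.1.1, Function.update q.1.2 i q.2)
  have hΦ (i : κ) : MeasurePreserving (Φ i) ((P.prod μ).prod ν) (P.prod μ) :=
    ((MeasurePreserving.id P).prod (measurePreserving_update_infinitePi (fun _ => ν) i)).comp
      (measurePreserving_prodAssoc P μ ν)
  have hΦk : Measurable fun q => Φ (k q.1) q :=
    (measurable_from_prod_countable_right (f := fun p : κ × _ => Φ p.1 p.2)
      fun i => (hΦ i).measurable).comp ((hk.comp measurable_fst).prodMk measurable_id)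
  have hk_resample (i : κ) (q) : k (Φ i q) = i ↔ k q.1 = i := by
    obtain ⟨⟨w, η⟩, z⟩ := q
    constructor
    · intro h
      have := hk_update w (Function.update η i z) (η i)
      simp only [Φ] at h
      rwa [h, Function.update_idem, Function.update_eq_self] at this
    · rintro rfl
      exact hk_update w η z
  refine ⟨hΦk, Measure.ext fun B hB => ?_⟩
  rw [Measure.map_apply hΦk hB, measure_eq_tsum_inter_preimage _ (hk.comp measurable_fst) (hΦk hB),
    measure_eq_tsum_inter_preimage _ hk hB]
  refine tsum_congr fun i => ?_
  rw [← (hΦ i).measure_preimage (hB.inter (hk (measurableSet_singleton i))).nullMeasurableSet]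
  congr 1
  ext q
  simp only [Set.mem_inter_iff, Set.mem_preimage, Set.mem_singleton_iff, Function.comp_apply,
    hk_resample]
  exact and_congr_left fun h => by rw [← h]

theorem map_prodMk_apply_randomIndex {β : Type*} [MeasurableSpace β] {k : Ω × (κ → Z) → κ}
    (hk : Measurable k) (hk_update : ∀ w η z, k (w, Function.update η (k (w, η)) z) = k (w, η))
    {F : Ω × (κ → Z) → β} (hF : Measurable F)
    (hF_update : ∀ w η z, F (w, Function.update η (k (w, η)) z) = F (w, η)) :
    (P.prod (Measure.infinitePi fun _ => ν)).map (fun p => (F p, p.2 (k p))) =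
      ((P.prod (Measure.infinitePi fun _ => ν)).map F).prod ν := by
  have hΦ := measurePreserving_update_randomIndex (P := P) (ν := ν) hk hk_update
  have happly : Measurable fun p : Ω × (κ → Z) => p.2 (k p) :=
    measurable_apply_index.comp (measurable_snd.prodMk hk)
  conv_lhs => rw [← hΦ.map_eq]
  rw [Measure.map_map (hF.prodMk happly) hΦ.measurable]
  have hcomp : (fun p => (F p, p.2 (k p))) ∘
      (fun q : (Ω × (κ → Z)) × Z => (q.1.1, Function.update q.1.2 (k q.1) q.2)) =
      Prod.map F id := by
    funext ⟨⟨w, η⟩, z⟩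
    simp [hF_update, hk_update]
  rw [hcomp, ← Measure.map_prod_map _ _ hF measurable_id, Measure.map_id]

end Resampling

section AdaptiveHistory

variable {Ω E Z κ : Type*}

/-- The history whose entries are `G` applied to the past and to one coordinate of the family `η`;
the coordinate to be read is chosen by `idx` from the internal randomness and the past. -/
def adaptiveHist (G : Ω → List E → Z → E) (idx : Ω → List E → κ) (w : Ω) (η : κ → Z) : ℕ → List E
  | 0 => []
  | j + 1 => adaptiveHist G idx w η j ++
      [G w (adaptiveHist G idx w η j) (η (idx w (adaptiveHist G idx w η j)))]

/-- A measurable choice of coordinates that never reads the same coordinate twice along a growing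
history. -/
structure IsFreshIndex [MeasurableSpace Ω] [MeasurableSpace E] [MeasurableSpace κ]
    (idx : Ω → List E → κ) : Prop where
  measurable : Measurable fun p : Ω × List E => idx p.1 p.2
  eq_of_isPrefix : ∀ w h h', h <+: h' → idx w h = idx w h' → h = h'

variable {G : Ω → List E → Z → E} {idx : Ω → List E → κ}

@[simp]
theorem length_adaptiveHist (w : Ω) (η : κ → Z) (j : ℕ) :
    (adaptiveHist G idx w η j).length = j := by
  induction j with
  | zero => rfl
  | succ j ih => simp [adaptiveHist, ih]

theorem adaptiveHist_isPrefix (w : Ω) (η : κ → Z) {i j : ℕ} (hij : i ≤ j) :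
    adaptiveHist G idx w η i <+: adaptiveHist G idx w η j := by
  induction j, hij using Nat.le_induction with
  | base => exact List.prefix_rfl
  | succ j _ ih => exact ih.trans (List.prefix_append _ _)

variable [MeasurableSpace Ω] [MeasurableSpace E] [MeasurableSpace κ]

theorem IsFreshIndex.adaptiveHist_update [DecidableEq κ] (hidx : IsFreshIndex idx) (w : Ω)
    (η : κ → Z) (z : Z) {i j : ℕ} (hij : i ≤ j) :
    adaptiveHist G idx w (Function.update η (idx w (adaptiveHist G idx w η j)) z) i =
      adaptiveHist G idx w η i := by
  induction i with
  | zero => rfl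
  | succ i ih =>
    have hne : idx w (adaptiveHist G idx w η i) ≠ idx w (adaptiveHist G idx w η j) := fun h => by
      have := congrArg List.length
        (hidx.eq_of_isPrefix w _ _ (adaptiveHist_isPrefix w η (by omega)) h)
      simp only [length_adaptiveHist] at this
      omega
    simp only [adaptiveHist, ih (by omega), Function.update_of_ne hne]

theorem isFreshIndex_length {ι : Type*} [MeasurableSpace ι] (i : ι) :
    IsFreshIndex fun (_ : Ω) (h : List E) => (i, h.length) where
  measurable := measurable_of_comp_prodMap_ofFn fun n => by
    simp only [List.length_ofFn, measurable_const]
  eq_of_isPrefix _ _ _ hh hidx := hh.eq_of_length (congrArg Prod.snd hidx)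

variable [MeasurableSpace Z] [Countable κ] [MeasurableSingletonClass κ]

theorem measurable_adaptiveHist (hG : Measurable fun q : (Ω × List E) × Z => G q.1.1 q.1.2 q.2)
    (hidx : Measurable fun p : Ω × List E => idx p.1 p.2) (j : ℕ) :
    Measurable fun p : Ω × (κ → Z) => adaptiveHist G idx p.1 p.2 j := by
  induction j with
  | zero => exact measurable_const
  | succ j ih =>
    have hpast : Measurable fun p : Ω × (κ → Z) => (p.1, adaptiveHist G idx p.1 p.2 j) :=
      measurable_fst.prodMk ih
    exact measurable_append_singleton.comp ((hG.comp (hpast.prodMk (measurable_apply_index.comp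
      (measurable_snd.prodMk (hidx.comp hpast))))).prodMk ih)

variable {P : Measure Ω} {ν : Measure Z} [IsProbabilityMeasure ν]

theorem IsFreshIndex.map_adaptiveHist_succ [SFinite P]
    (hG : Measurable fun q : (Ω × List E) × Z => G q.1.1 q.1.2 q.2) (hidx : IsFreshIndex idx)
    (j : ℕ) :
    (P.prod (Measure.infinitePi fun _ : κ => ν)).map
        (fun p => (p.1, adaptiveHist G idx p.1 p.2 (j + 1))) =
      (((P.prod (Measure.infinitePi fun _ : κ => ν)).map
        fun p => (p.1, adaptiveHist G idx p.1 p.2 j)).prod ν).map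
          fun q => (q.1.1, q.1.2 ++ [G q.1.1 q.1.2 q.2]) := by
  classical
  have hpast : Measurable fun p : Ω × (κ → Z) => (p.1, adaptiveHist G idx p.1 p.2 j) :=
    measurable_fst.prodMk (measurable_adaptiveHist hG hidx.measurable j)
  have hstep : Measurable fun q : (Ω × List E) × Z => (q.1.1, q.1.2 ++ [G q.1.1 q.1.2 q.2]) :=
    (measurable_fst.comp measurable_fst).prodMk
      (measurable_append_singleton.comp (hG.prodMk (measurable_snd.comp measurable_fst)))
  have hnext : Measurable fun p : Ω × (κ → Z) => idx p.1 (adaptiveHist G idx p.1 p.2 j) :=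
    hidx.measurable.comp hpast
  have hread : Measurable fun p : Ω × (κ → Z) => p.2 (idx p.1 (adaptiveHist G idx p.1 p.2 j)) :=
    measurable_apply_index.comp (measurable_snd.prodMk hnext)
  rw [← map_prodMk_apply_randomIndex hnext
      (fun w η z => by simp only [hidx.adaptiveHist_update w η z le_rfl]) hpast
      (fun w η z => by simp only [hidx.adaptiveHist_update w η z le_rfl]),
    Measure.map_map hstep (hpast.prodMk hread)]
  rfl

/-- Coordinates that have never been read are fresh samples, whatever the order of reading. -/
theorem map_adaptiveHist_eq_of_isFreshIndex [SFinite P] {κ' : Type*} [Countable κ']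
    [MeasurableSpace κ'] [MeasurableSingletonClass κ'] {idx' : Ω → List E → κ'}
    (hG : Measurable fun q : (Ω × List E) × Z => G q.1.1 q.1.2 q.2) (hidx : IsFreshIndex idx)
    (hidx' : IsFreshIndex idx') (j : ℕ) :
    (P.prod (Measure.infinitePi fun _ : κ => ν)).map
        (fun p => (p.1, adaptiveHist G idx p.1 p.2 j)) =
      (P.prod (Measure.infinitePi fun _ : κ' => ν)).map
        (fun p => (p.1, adaptiveHist G idx' p.1 p.2 j)) := by
  induction j with
  | zero =>
    have hnil : Measurable fun w : Ω => (w, ([] : List E)) := measurable_id.prodMk measurable_const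
    refine (Measure.map_map hnil measurable_fst).symm.trans
      (.trans ?_ (Measure.map_map hnil measurable_fst))
    simp only [Measure.map_fst_prod, measure_univ, one_smul]
  | succ j ih => rw [hidx.map_adaptiveHist_succ hG, hidx'.map_adaptiveHist_succ hG, ih]

end AdaptiveHistory

section Buffers

variable {d : ℕ} {ι Ω : Type*} {X : Finset (Act d)} [MeasurableSpace Ω]

/-- The buffers without the rewards: `avail x` are the agents whose latest reward for `x` is
unread, `stamp x` is the time-step at which `B_x` was last filled and `time` is the number of
time-steps used so far. The noise variable of agent `b` at time-step `t` is named by `(b, t)`. -/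
@[ext]
structure BufState (X : Finset (Act d)) (ι : Type*) where
  avail : X → Finset ι
  stamp : X → ℕ
  time : ℕ

namespace BufState

instance instCountable [Finite ι] : Countable (BufState X ι) := by
  have : Function.Injective fun D : BufState X ι => (D.avail, D.stamp, D.time) := by
    intro D D' h
    simp only [Prod.mk.injEq] at h
    exact BufState.ext h.1 h.2.1 h.2.2
  exact this.countable

instance : MeasurableSpace (BufState X ι) := ⊤

instance : DiscreteMeasurableSpace (BufState X ι) := ⟨fun _ => trivial⟩

/-- All buffers empty, before the first time-step. -/
def init : BufState X ι := ⟨fun _ => ∅, fun _ => 0, 0⟩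

open Classical in
/-- Use one time-step to fill the buffer of `x` if it is empty. -/
noncomputable def refill [Fintype ι] (D : BufState X ι) (x : X) : BufState X ι :=
  if (D.avail x).Nonempty then D
  else ⟨Function.update D.avail x Finset.univ, Function.update D.stamp x D.time, D.time + 1⟩

open Classical in
/-- Remove the reward of agent `b` from the buffer of `x`. -/
noncomputable def take (D : BufState X ι) (x : X) (b : ι) : BufState X ι :=
  { D with avail := Function.update D.avail x ((D.avail x).erase b) }

/-- The noise variable `k` does not belong to a reward that has been removed. -/
def Unread (D : BufState X ι) (k : ι × ℕ) : Prop :=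
  D.time ≤ k.2 ∨ ∃ x, k.1 ∈ D.avail x ∧ D.stamp x = k.2

/-- The non-empty buffers were filled at different time-steps in the past. -/
structure Valid (D : BufState X ι) : Prop where
  stamp_lt : ∀ x, (D.avail x).Nonempty → D.stamp x < D.time
  stamp_inj : ∀ x x', (D.avail x).Nonempty → (D.avail x').Nonempty → D.stamp x = D.stamp x' →
    x = x'

variable {D : BufState X ι} {x : X}

theorem valid_init : (init : BufState X ι).Valid := ⟨by simp [init], by simp [init]⟩

theorem refill_of_nonempty [Fintype ι] (h : (D.avail x).Nonempty) : D.refill x = D := by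
  simp [refill, h]

theorem refill_nonempty [Fintype ι] [Nonempty ι] (D : BufState X ι) (x : X) :
    ((D.refill x).avail x).Nonempty := by
  by_cases h : (D.avail x).Nonempty
  · rwa [refill_of_nonempty h]
  · simp [refill, h]

theorem time_le_refill [Fintype ι] (D : BufState X ι) (x : X) : D.time ≤ (D.refill x).time := by
  unfold refill
  split_ifs <;> simp

theorem Valid.refill [Fintype ι] (hD : D.Valid) (x : X) : (D.refill x).Valid := by
  by_cases h : (D.avail x).Nonempty
  · rwa [refill_of_nonempty h]
  · simp only [BufState.refill, h, if_false]
    have hlt := hD.stamp_lt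
    have hinj := hD.stamp_inj
    constructor <;> grind [Function.update_apply]

theorem Unread.of_refill [Fintype ι] {k : ι × ℕ} (hk : (D.refill x).Unread k) : D.Unread k := by
  by_cases h : (D.avail x).Nonempty
  · rwa [refill_of_nonempty h] at hk
  · simp only [refill, h, if_false, Unread] at hk ⊢
    grind [Function.update_apply]

theorem take_avail_subset (D : BufState X ι) (x y : X) (b : ι) :
    (D.take x b).avail y ⊆ D.avail y := by
  classical
  intro a ha
  simp only [take, Function.update_apply] at ha
  grind

theorem Valid.take (hD : D.Valid) (x : X) (b : ι) : (D.take x b).Valid :=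
  ⟨fun y hy => hD.stamp_lt y (hy.mono (D.take_avail_subset x y b)),
    fun y y' hy hy' => hD.stamp_inj y y' (hy.mono (D.take_avail_subset x y b))
      (hy'.mono (D.take_avail_subset x y' b))⟩

theorem Unread.of_take {b : ι} {k : ι × ℕ} (hk : (D.take x b).Unread k) : D.Unread k :=
  hk.imp_right fun ⟨y, hy, hyk⟩ => ⟨y, D.take_avail_subset x y b hy, hyk⟩

theorem Valid.not_unread_take (hD : D.Valid) {b : ι} (hb : b ∈ D.avail x) :
    ¬ (D.take x b).Unread (b, D.stamp x) := by
  rintro (htime | ⟨y, hy, hyx⟩)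
  · exact absurd (hD.stamp_lt x ⟨b, hb⟩) (not_lt.mpr htime)
  · obtain rfl := hD.stamp_inj y x ⟨b, D.take_avail_subset x y b hy⟩ ⟨b, hb⟩ hyx
    simp [BufState.take] at hy

end BufState

/-- The action requested by the single-agent algorithm. -/
def SingleAlg.request (S : SingleAlg d X Ω) (w : Ω) (h : List (Act d × ℝ)) : X :=
  ⟨S.act w h, S.act_mem w h⟩

variable [Fintype ι] [Nonempty ι]

namespace BufState

/-- The agent whose reward for `x` is removed next. -/
noncomputable def label (ρ : RemovalRule d ι) (D : BufState X ι) (h : List (Act d × ℝ)) (x : X) :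
    ι :=
  ρ.pick h x ((D.refill x).avail x) (D.refill_nonempty x)

/-- The noise variable that is read next. -/
noncomputable def readIdx (ρ : RemovalRule d ι) (D : BufState X ι) (h : List (Act d × ℝ)) (x : X) :
    ι × ℕ :=
  (D.label ρ h x, (D.refill x).stamp x)

/-- The buffers after the next reward, which is for the action `x`, has been removed. -/
noncomputable def advance (ρ : RemovalRule d ι) (D : BufState X ι) (h : List (Act d × ℝ)) (x : X) :
    BufState X ι :=
  (D.refill x).take x (D.label ρ h x)

variable {ρ : RemovalRule d ι} {D : BufState X ι} {h : List (Act d × ℝ)} {x : X}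

theorem label_mem : D.label ρ h x ∈ (D.refill x).avail x :=
  ρ.pick_mem _ _ _ _

theorem Valid.advance (hD : D.Valid) : (D.advance ρ h x).Valid :=
  (hD.refill _).take _ _

theorem unread_readIdx : D.Unread (D.readIdx ρ h x) :=
  Unread.of_refill (x := x) (Or.inr ⟨x, label_mem, rfl⟩)

theorem Unread.of_advance {k : ι × ℕ} (hk : (D.advance ρ h x).Unread k) : D.Unread k :=
  hk.of_take.of_refill

theorem Valid.not_unread_advance (hD : D.Valid) :
    ¬ (D.advance ρ h x).Unread (D.readIdx ρ h x) :=
  (hD.refill x).not_unread_take label_mem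

theorem time_le_advance (D : BufState X ι) : D.time ≤ (D.advance ρ h x).time :=
  D.time_le_refill x

end BufState

/-- The buffers of the meta-algorithm once the simulated history `h` has been read. They depend on
`h` alone, which is what makes the reading order adapted. -/
noncomputable def buffers (S : SingleAlg d X Ω) (ρ : RemovalRule d ι) (w : Ω)
    (h : List (Act d × ℝ)) : BufState X ι :=
  h.reverseRecOn .init fun l _ D => D.advance ρ l (S.request w l)

/-- The noise variable that the meta-algorithm reads after the simulated history `h`. -/
noncomputable def bufferIdx (S : SingleAlg d X Ω) (ρ : RemovalRule d ι) (w : Ω)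
    (h : List (Act d × ℝ)) : ι × ℕ :=
  (buffers S ρ w h).readIdx ρ h (S.request w h)

variable (S : SingleAlg d X Ω) (ρ : RemovalRule d ι) (w : Ω)

@[simp]
theorem buffers_nil : buffers S ρ w [] = .init :=
  List.reverseRecOn_nil (motive := fun _ => BufState X ι) _ _

@[simp]
theorem buffers_concat (h : List (Act d × ℝ)) (e : Act d × ℝ) :
    buffers S ρ w (h ++ [e]) = (buffers S ρ w h).advance ρ h (S.request w h) :=
  List.reverseRecOn_concat (motive := fun _ => BufState X ι) _ _ _ _

theorem valid_buffers (h : List (Act d × ℝ)) : (buffers S ρ w h).Valid := by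
  induction h using List.reverseRecOn with
  | nil => exact buffers_nil S ρ w ▸ BufState.valid_init
  | append_singleton h e ih => exact buffers_concat S ρ w h e ▸ ih.advance

theorem monotone_time_buffers {h h' : List (Act d × ℝ)} (hh : h <+: h') :
    (buffers S ρ w h).time ≤ (buffers S ρ w h').time := by
  obtain ⟨l, rfl⟩ := hh
  induction l using List.reverseRecOn with
  | nil => simp
  | append_singleton l e ih =>
    rw [← List.append_assoc, buffers_concat]
    exact ih.trans (BufState.time_le_advance _)

theorem unread_buffers_of_isPrefix {h h' : List (Act d × ℝ)} (hh : h <+: h') {k : ι × ℕ}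
    (hk : (buffers S ρ w h').Unread k) : (buffers S ρ w h).Unread k := by
  obtain ⟨l, rfl⟩ := hh
  induction l using List.reverseRecOn with
  | nil => simpa using hk
  | append_singleton l e ih =>
    rw [← List.append_assoc, buffers_concat] at hk
    exact ih hk.of_advance

theorem eq_of_isPrefix_of_bufferIdx_eq {h h' : List (Act d × ℝ)} (hh : h <+: h')
    (hidx : bufferIdx S ρ w h = bufferIdx S ρ w h') : h = h' := by
  obtain ⟨_ | ⟨e, l⟩, rfl⟩ := hh
  · simp
  · have hunread : (buffers S ρ w (h ++ [e])).Unread (bufferIdx S ρ w h) := by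
      rw [hidx]
      exact unread_buffers_of_isPrefix S ρ w ⟨l, by simp⟩ BufState.unread_readIdx
    rw [buffers_concat] at hunread
    exact absurd hunread (valid_buffers S ρ w h).not_unread_advance

section Measurability

theorem measurable_act_list : Measurable fun p : Ω × List (Act d × ℝ) => S.act p.1 p.2 :=
  measurable_of_comp_prodMap_ofFn S.measurable_act

theorem measurable_request : Measurable fun p : Ω × List (Act d × ℝ) => S.request p.1 p.2 :=
  (measurable_act_list S).subtype_mk

variable [MeasurableSpace ι]

theorem measurable_label (D : BufState X ι) (x : X) :
    Measurable fun h : List (Act d × ℝ) => D.label ρ h x :=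
  measurable_to_countable' fun b => measurableSet_list_iff.mpr fun n =>
    ρ.measurable_pick n x _ (D.refill_nonempty x) b

variable [DiscreteMeasurableSpace ι]

theorem measurable_buffers :
    Measurable fun p : Ω × List (Act d × ℝ) => buffers S ρ p.1 p.2 := by
  have hadvance : Measurable fun q : (Ω × List (Act d × ℝ)) × BufState X ι × X =>
      q.2.1.advance ρ q.1.2 q.2.2 :=
    measurable_from_prod_countable_left fun ⟨D, x⟩ =>
      (Measurable.of_discrete (f := (D.refill x).take x)).comp
        ((measurable_label ρ D x).comp measurable_snd)
  refine measurable_of_comp_prodMap_ofFn fun n => ?_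
  induction n with
  | zero => simp only [List.ofFn_zero, buffers_nil, measurable_const]
  | succ n ih =>
    have hpast : Measurable fun p : Ω × (Fin (n + 1) → Act d × ℝ) =>
        (p.1, fun i => p.2 (Fin.castSucc i)) := by fun_prop
    have hhist : Measurable fun p : Ω × (Fin n → Act d × ℝ) => (p.1, List.ofFn p.2) :=
      measurable_id.prodMap (measurableEmbedding_ofFn n).measurable
    simp only [List.ofFn_succ_last, buffers_concat]
    exact hadvance.comp ((hhist.comp hpast).prodMk
      ((ih.comp hpast).prodMk ((measurable_request S).comp (hhist.comp hpast))))

theorem measurable_bufferIdx :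
    Measurable fun p : Ω × List (Act d × ℝ) => bufferIdx S ρ p.1 p.2 := by
  have hread : Measurable fun q : (Ω × List (Act d × ℝ)) × BufState X ι × X =>
      q.2.1.readIdx ρ q.1.2 q.2.2 :=
    measurable_from_prod_countable_left fun ⟨D, x⟩ =>
      ((measurable_label ρ D x).comp measurable_snd).prodMk
        (measurable_const (a := (D.refill x).stamp x))
  exact hread.comp (measurable_id.prodMk ((measurable_buffers S ρ).prodMk (measurable_request S)))

theorem isFreshIndex_bufferIdx : IsFreshIndex (bufferIdx S ρ) where
  measurable := measurable_bufferIdx S ρ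
  eq_of_isPrefix w _ _ := eq_of_isPrefix_of_bufferIdx_eq S ρ w

end Measurability

end Buffers

section MetaAlgorithm

variable {d : ℕ} {ι Ω : Type*} {X : Finset (Act d)} [MeasurableSpace Ω]

open Classical in
theorem sum_card_update_mul (f : Act d → Finset ι) (B : Finset ι) (g : Act d → ℝ) {y : Act d}
    (hy : y ∈ X) :
    ∑ x ∈ X, ((Function.update f y B x).card : ℝ) * g x =
      ∑ x ∈ X, ((f x).card : ℝ) * g x + ((B.card : ℝ) - (f y).card) * g y := by
  have hcongr : ∑ x ∈ X.erase y, ((Function.update f y B x).card : ℝ) * g x =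
      ∑ x ∈ X.erase y, ((f x).card : ℝ) * g x :=
    Finset.sum_congr rfl fun x hx => by rw [Function.update_of_ne (Finset.ne_of_mem_erase hx)]
  rw [← Finset.add_sum_erase X _ hy, ← Finset.add_sum_erase X (fun x => (_ : ℝ) * g x) hy, hcongr,
    Function.update_self]
  ring

/-- What the single-agent algorithm plays and observes after the history `h` when the noise
variable is `z`. -/
noncomputable def SingleAlg.outcome (S : SingleAlg d X Ω) (θ : Act d) (w : Ω)
    (h : List (Act d × ℝ)) (z : ℝ) : Act d × ℝ :=
  (S.act w h, inner ℝ θ (S.act w h) + z)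

namespace MulState

/-- The total weight of all rewards in the simulated history and in the buffers, a reward for the
action `x` having the weight `g x`. It is the quantity that the `while` loop conserves. -/
noncomputable def weight (X : Finset (Act d)) (g : Act d → ℝ) (s : MulState d ι) : ℝ :=
  (s.hist.map fun q => g q.1).sum + ∑ x ∈ X, ((s.avail x).card : ℝ) * g x

open Classical in
/-- The state in which the `while` loop is entered after all agents have played the requested
action with outcomes `p`. -/
noncomputable def fill [Fintype ι] (S : SingleAlg d X Ω) (w : Ω) (s : MulState d ι)
    (p : ι → Act d × ℝ) : MulState d ι :=
  { hist := s.hist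
    avail := Function.update s.avail (s.next S w) Finset.univ
    val := Function.update s.val (s.next S w) fun b => (p b).2 }

variable (S : SingleAlg d X Ω) (ρ : RemovalRule d ι) (w : Ω) (s : MulState d ι)

theorem next_mem : s.next S w ∈ X :=
  S.act_mem w s.hist

theorem read_avail_subset (x : Act d) : (s.read S ρ w).avail x ⊆ s.avail x := by
  classical
  by_cases h : (s.avail (s.next S w)).Nonempty
  · by_cases hx : x = s.next S w
    · subst hx
      simpa [MulState.read, h] using Finset.erase_subset _ _
    · simp [MulState.read, h, hx]
  · rw [read_of_empty S ρ w s (Finset.not_nonempty_iff_eq_empty.mp h)]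

theorem iterate_read_avail_subset (m : ℕ) (x : Act d) :
    ((MulState.read S ρ w)^[m] s).avail x ⊆ s.avail x := by
  induction m with
  | zero => exact subset_rfl
  | succ m ih =>
    rw [Function.iterate_succ_apply']
    exact (read_avail_subset S ρ w _ x).trans ih

theorem card_avail_read_next_lt (h : (s.avail (s.next S w)).Nonempty) :
    ((s.read S ρ w).avail (s.next S w)).card < (s.avail (s.next S w)).card := by
  classical
  simp only [MulState.read, h, dite_true, Function.update_self]
  exact Finset.card_erase_lt_of_mem (ρ.pick_mem _ _ _ _)

theorem weight_read (g : Act d → ℝ) : (s.read S ρ w).weight X g = s.weight X g := by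
  classical
  by_cases h : (s.avail (s.next S w)).Nonempty
  · have hcard := Finset.card_erase_add_one (ρ.pick_mem s.hist (s.next S w) _ h)
    simp only [weight, MulState.read, h, dite_true, List.map_append, List.sum_append,
      List.map_cons, List.map_nil, List.sum_singleton]
    rw [sum_card_update_mul _ _ g (s.next_mem S w), ← hcard]
    push_cast
    ring
  · rw [read_of_empty S ρ w s (Finset.not_nonempty_iff_eq_empty.mp h)]

theorem weight_iterate_read (g : Act d → ℝ) (m : ℕ) :
    ((MulState.read S ρ w)^[m] s).weight X g = s.weight X g := by
  induction m with
  | zero => rfl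
  | succ m ih => rw [Function.iterate_succ_apply', weight_read, ih]

variable [Fintype ι] (p : ι → Act d × ℝ)

theorem weight_fill (g : Act d → ℝ) (h : s.avail (s.next S w) = ∅) :
    (s.fill S w p).weight X g = s.weight X g + Fintype.card ι * g (s.next S w) := by
  classical
  simp only [weight, fill, sum_card_update_mul _ _ g (s.next_mem S w), h,
    Finset.card_univ, Finset.card_empty, Nat.cast_zero, sub_zero, add_assoc]

theorem weight_round (g : Act d → ℝ) (h : s.avail (s.next S w) = ∅) :
    (s.round S ρ w p).weight X g = s.weight X g + Fintype.card ι * g (s.next S w) :=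
  (weight_iterate_read S ρ w _ g _).trans (weight_fill S w s p g h)

variable [Nonempty ι]

theorem fill_avail_next_nonempty :
    ((s.fill S w p).avail ((s.fill S w p).next S w)).Nonempty := by
  classical
  change (Function.update s.avail (s.next S w) Finset.univ (s.next S w)).Nonempty
  simp

theorem exists_round_eq_iterate_read :
    ∃ m, s.round S ρ w p = (MulState.read S ρ w)^[m] ((s.fill S w p).read S ρ w) := by
  have hsize : (s.fill S w p).size X ≠ 0 :=
    (Nat.zero_le _).trans_lt (size_read S ρ w _ (fill_avail_next_nonempty S w s p)) |>.ne'
  obtain ⟨m, hm⟩ := Nat.exists_eq_succ_of_ne_zero hsize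
  exact ⟨m, (congrArg (fun n => (MulState.read S ρ w)^[n] (s.fill S w p)) hm).trans
    (Function.iterate_succ_apply _ _ _)⟩

theorem card_avail_round_lt {x : Act d} (hx : (s.avail x).card < Fintype.card ι) :
    ((s.round S ρ w p).avail x).card < Fintype.card ι := by
  classical
  obtain ⟨m, hm⟩ := s.exists_round_eq_iterate_read S ρ w p
  rw [hm]
  refine (Finset.card_le_card (iterate_read_avail_subset S ρ w _ m x)).trans_lt ?_
  by_cases hxn : x = s.next S w
  · subst hxn
    exact (card_avail_read_next_lt S ρ w _ (fill_avail_next_nonempty S w s p)).trans_le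
      (Finset.card_le_univ _)
  · refine (Finset.card_le_card (read_avail_subset S ρ w _ x)).trans_lt ?_
    simpa only [fill, Function.update_of_ne hxn] using hx

end MulState

namespace MulState

/-- The state `s` has the simulated history `h` and the buffers `D`, the rewards being obtained
from the noise `η`. -/
structure Matches (θ : Act d) (η : ι × ℕ → ℝ) (s : MulState d ι) (h : List (Act d × ℝ))
    (D : BufState X ι) : Prop where
  hist : s.hist = h
  avail : ∀ x : X, s.avail x = D.avail x
  val : ∀ (x : X) (b : ι), b ∈ D.avail x → s.val x b = inner ℝ θ (x : Act d) + η (b, D.stamp x)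

variable {S : SingleAlg d X Ω} {w : Ω} {θ : Act d} {η : ι × ℕ → ℝ}
  {s : MulState d ι} {h : List (Act d × ℝ)} {D : BufState X ι}

theorem Matches.next_eq (hs : s.Matches θ η h D) : s.next S w = S.request w h := by
  rw [MulState.next, hs.hist]
  rfl

theorem Matches.avail_next (hs : s.Matches θ η h D) :
    s.avail (s.next S w) = D.avail (S.request w h) := by
  rw [hs.next_eq, hs.avail]

end MulState

variable [Fintype ι]

namespace BanditInstance

/-- The state of the meta-algorithm after `t` time-steps. -/
noncomputable def mulState (J : BanditInstance d ι) (S : SingleAlg d X Ω) (ρ : RemovalRule d ι)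
    (w : Ω) (η : ι × ℕ → ℝ) (t : ℕ) : MulState d ι :=
  (J.history (mul S ρ) w η t).foldl (MulState.round S ρ w) ⟨[], fun _ => ∅, fun _ _ => 0⟩

/-- The action that all agents play in the meta-algorithm after `t` time-steps. -/
noncomputable def mulAct (J : BanditInstance d ι) (S : SingleAlg d X Ω) (ρ : RemovalRule d ι)
    (w : Ω) (η : ι × ℕ → ℝ) (t : ℕ) : Act d :=
  (J.mulState S ρ w η t).next S w

variable (J : BanditInstance d ι) (S : SingleAlg d X Ω) (ρ : RemovalRule d ι) (w : Ω)
  (η : ι × ℕ → ℝ) (t : ℕ)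

theorem mulState_succ :
    J.mulState S ρ w η (t + 1) = (J.mulState S ρ w η t).round S ρ w fun a =>
      (J.mulAct S ρ w η t, inner ℝ J.theta (J.mulAct S ρ w η t) + η (a, t)) := by
  simp only [mulState, history, List.foldl_append, List.foldl_cons, List.foldl_nil]
  rfl

theorem mulState_avail_mulAct : (J.mulState S ρ w η t).avail (J.mulAct S ρ w η t) = ∅ := by
  cases t with
  | zero => rfl
  | succ t =>
    rw [mulAct, mulState_succ]
    exact MulState.drain_exit S ρ w _

theorem weight_mulState (g : Act d → ℝ) :
    (J.mulState S ρ w η t).weight X g =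
      Fintype.card ι * ∑ s ∈ Finset.range t, g (J.mulAct S ρ w η s) := by
  induction t with
  | zero => simp [mulState, history, MulState.weight]
  | succ t ih =>
    rw [mulState_succ, MulState.weight_round S ρ w _ _ g (J.mulState_avail_mulAct S ρ w η t), ih,
      Finset.sum_range_succ, mul_add]
    rfl

theorem card_avail_mulState_lt [Nonempty ι] (x : Act d) :
    ((J.mulState S ρ w η t).avail x).card < Fintype.card ι := by
  induction t with
  | zero => simpa [mulState, history] using Fintype.card_pos
  | succ t ih =>
    rw [mulState_succ]
    exact MulState.card_avail_round_lt S ρ w _ _ ih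

end BanditInstance

namespace MulState

variable {S : SingleAlg d X Ω} {w : Ω} {θ : Act d} {η : ι × ℕ → ℝ} {s : MulState d ι}
  {h : List (Act d × ℝ)} {D : BufState X ι}

theorem Matches.fill (hs : s.Matches θ η h D) (hempty : s.avail (s.next S w) = ∅) :
    (s.fill S w fun a =>
      (s.next S w, inner ℝ θ (s.next S w) + η (a, D.time))).Matches θ η h
        (D.refill (S.request w h)) := by
  classical
  have hD : ¬ (D.avail (S.request w h)).Nonempty := by
    rw [← hs.avail_next, hempty]
    exact Finset.not_nonempty_empty
  simp only [BufState.refill, hD, if_false]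
  refine ⟨hs.hist, fun x => ?_, fun x b hb => ?_⟩ <;>
    obtain rfl | hx := eq_or_ne x (S.request w h)
  · simp [MulState.fill, hs.next_eq]
  · simp [MulState.fill, hs.next_eq, hx, hs.avail, Subtype.coe_injective.ne hx]
  · simp [MulState.fill, hs.next_eq]
  · simp only [Function.update_of_ne hx] at hb ⊢
    simpa [MulState.fill, hs.next_eq, Subtype.coe_injective.ne hx] using hs.val x b hb

end MulState

variable [Nonempty ι]

/-- The history that the meta-algorithm simulates, after `j` of its entries. -/
noncomputable abbrev simulatedHist (S : SingleAlg d X Ω) (ρ : RemovalRule d ι) (θ : Act d) (w : Ω)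
    (η : ι × ℕ → ℝ) (j : ℕ) : List (Act d × ℝ) :=
  adaptiveHist (S.outcome θ) (bufferIdx S ρ) w η j

namespace MulState

variable {S : SingleAlg d X Ω} {ρ : RemovalRule d ι} {w : Ω} {θ : Act d} {η : ι × ℕ → ℝ}
  {s : MulState d ι}

theorem Matches.read {h : List (Act d × ℝ)} {D : BufState X ι}
    (hs : s.Matches θ η h (D.refill (S.request w h))) :
    (s.read S ρ w).Matches θ η
      (h ++ [S.outcome θ w h (η (D.readIdx ρ h (S.request w h)))])
      (D.advance ρ h (S.request w h)) := by
  classical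
  have hne : (s.avail (s.next S w)).Nonempty := by
    rw [hs.avail_next]
    exact D.refill_nonempty _
  have hpick : ρ.pick s.hist (s.next S w) (s.avail (s.next S w)) hne =
      D.label ρ h (S.request w h) := by
    unfold BufState.label
    congr 1
    · exact hs.hist
    · exact hs.next_eq
    · exact hs.avail_next
  refine ⟨?_, fun x => ?_, fun x b hxb => ?_⟩ <;>
    simp only [MulState.read, hne, dite_true, hpick]
  · rw [hs.next_eq, hs.hist, hs.val _ _ BufState.label_mem]
    rfl
  · rw [hs.next_eq, hs.avail]
    obtain rfl | hx := eq_or_ne x (S.request w h)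
    · simp [BufState.advance, BufState.take]
    · simp [BufState.advance, BufState.take, hx, Subtype.coe_injective.ne hx, hs.avail]
  · exact hs.val x b (BufState.take_avail_subset _ _ _ _ hxb)

variable {j : ℕ}

theorem Matches.iterate_read (m : ℕ)
    (hs : s.Matches θ η (simulatedHist S ρ θ w η j) (buffers S ρ w (simulatedHist S ρ θ w η j))) :
    ∃ j', ((MulState.read S ρ w)^[m] s).Matches θ η (simulatedHist S ρ θ w η j')
        (buffers S ρ w (simulatedHist S ρ θ w η j')) ∧
      (buffers S ρ w (simulatedHist S ρ θ w η j')).time =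
        (buffers S ρ w (simulatedHist S ρ θ w η j)).time := by
  induction m with
  | zero => exact ⟨j, hs, rfl⟩
  | succ m ih =>
    obtain ⟨i, hi, htime⟩ := ih
    rw [Function.iterate_succ_apply']
    set s' := (MulState.read S ρ w)^[m] s
    by_cases hne : (s'.avail (s'.next S w)).Nonempty
    · have hrefill := BufState.refill_of_nonempty (hi.avail_next (S := S) (w := w) ▸ hne)
      have hread := Matches.read (S := S) (ρ := ρ) (w := w) (hrefill.symm ▸ hi)
      refine ⟨i + 1, ?_, ?_⟩ <;> simp only [simulatedHist, adaptiveHist, buffers_concat]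
      · exact hread
      · exact (congrArg BufState.time hrefill).trans htime
    · rw [read_of_empty S ρ w s' (Finset.not_nonempty_iff_eq_empty.mp hne)]
      exact ⟨i, hi, htime⟩

theorem Matches.round
    (hs : s.Matches θ η (simulatedHist S ρ θ w η j) (buffers S ρ w (simulatedHist S ρ θ w η j)))
    (hempty : s.avail (s.next S w) = ∅) {t : ℕ}
    (ht : (buffers S ρ w (simulatedHist S ρ θ w η j)).time = t) :
    ∃ j', (s.round S ρ w fun a =>
        (s.next S w, inner ℝ θ (s.next S w) + η (a, t))).Matches θ η
          (simulatedHist S ρ θ w η j') (buffers S ρ w (simulatedHist S ρ θ w η j')) ∧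
      (buffers S ρ w (simulatedHist S ρ θ w η j')).time = t + 1 := by
  subst ht
  have hread := Matches.read (S := S) (ρ := ρ) (w := w) (hs.fill hempty)
  obtain ⟨m, hm⟩ := s.exists_round_eq_iterate_read S ρ w fun a => (s.next S w,
    inner ℝ θ (s.next S w) + η (a, (buffers S ρ w (simulatedHist S ρ θ w η j)).time))
  have hsucc : buffers S ρ w (simulatedHist S ρ θ w η (j + 1)) =
      (buffers S ρ w (simulatedHist S ρ θ w η j)).advance ρ (simulatedHist S ρ θ w η j)
        (S.request w (simulatedHist S ρ θ w η j)) :=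
    buffers_concat S ρ w _ _
  obtain ⟨j', hj', htime⟩ := Matches.iterate_read (j := j + 1) m (hsucc ▸ hread)
  refine ⟨j', hm ▸ hj', htime.trans ?_⟩
  have hD : (buffers S ρ w (simulatedHist S ρ θ w η j)).avail
      (S.request w (simulatedHist S ρ θ w η j)) = ∅ := hs.avail_next.symm.trans hempty
  rw [hsucc, BufState.advance, BufState.take, BufState.refill, if_neg (by simp [hD])]

end MulState

theorem BanditInstance.exists_matches_mulState (J : BanditInstance d ι) (S : SingleAlg d X Ω)
    (ρ : RemovalRule d ι) (w : Ω) (η : ι × ℕ → ℝ) (t : ℕ) :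
    ∃ j, (J.mulState S ρ w η t).Matches J.theta η (simulatedHist S ρ J.theta w η j)
        (buffers S ρ w (simulatedHist S ρ J.theta w η j)) ∧
      (buffers S ρ w (simulatedHist S ρ J.theta w η j)).time = t := by
  induction t with
  | zero => exact ⟨0, ⟨rfl, by simp [mulState, history, BufState.init, adaptiveHist],
      by simp [BufState.init, adaptiveHist]⟩, by simp [BufState.init, adaptiveHist]⟩
  | succ t ih =>
    obtain ⟨j, hj, ht⟩ := ih
    rw [J.mulState_succ]
    exact hj.round (J.mulState_avail_mulAct S ρ w η t) ht

end MetaAlgorithm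

section Regret

variable {d : ℕ} {ι Ω : Type*} {X : Finset (Act d)} [MeasurableSpace Ω]

/-- The regret of one play of `x`. -/
noncomputable def actionGap (θ : Act d) (X : Finset (Act d)) (x : Act d) : ℝ :=
  sSup ((fun x => inner ℝ θ x) '' (X : Set (Act d))) - inner ℝ θ x

section ActionGap

variable {θ x : Act d}

theorem actionGap_nonneg (hx : x ∈ X) : 0 ≤ actionGap θ X x :=
  sub_nonneg.mpr (le_csSup (X.finite_toSet.image _).bddAbove ⟨x, hx, rfl⟩)

theorem actionGap_le_maxGap (hx : x ∈ X) : actionGap θ X x ≤ maxGap θ X :=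
  sub_le_sub_left (csInf_le (X.finite_toSet.image _).bddBelow ⟨x, hx, rfl⟩) _

theorem maxGap_nonneg (θ : Act d) (X : Finset (Act d)) : 0 ≤ maxGap θ X :=
  sub_nonneg.mpr (Real.sInf_le_sSup _ (X.finite_toSet.image _).bddBelow
    (X.finite_toSet.image _).bddAbove)

theorem measurable_actionGap (θ : Act d) (X : Finset (Act d)) : Measurable (actionGap θ X) :=
  measurable_const.sub (measurable_const.inner measurable_id)

variable {P : Measure Ω} {Y : Ω → Act d}

theorem integrable_actionGap [IsFiniteMeasure P] (hY : Measurable Y) (hX : ∀ w, Y w ∈ X) :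
    Integrable (fun w => actionGap θ X (Y w)) P :=
  .of_bound ((measurable_actionGap θ X).comp hY).aestronglyMeasurable (maxGap θ X)
    (.of_forall fun w => (Real.norm_of_nonneg (actionGap_nonneg (hX w))).trans_le
      (actionGap_le_maxGap (hX w)))

variable [IsProbabilityMeasure P]

theorem integral_actionGap (hY : Measurable Y) (hX : ∀ w, Y w ∈ X) :
    ∫ w, actionGap θ X (Y w) ∂P =
      sSup ((fun x => inner ℝ θ x) '' (X : Set (Act d))) - ∫ w, inner ℝ θ (Y w) ∂P := by
  have hinner : (fun w => (inner ℝ θ (Y w) : ℝ)) = fun w =>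
      sSup ((fun x => inner ℝ θ x) '' (X : Set (Act d))) - actionGap θ X (Y w) := by
    simp only [actionGap, sub_sub_cancel]
  rw [hinner, integral_sub (integrable_const _) (integrable_actionGap hY hX), integral_const,
    probReal_univ, one_smul, sub_sub_cancel]

theorem integral_actionGap_le_maxGap (hY : Measurable Y) (hX : ∀ w, Y w ∈ X) :
    ∫ w, actionGap θ X (Y w) ∂P ≤ maxGap θ X := by
  refine (integral_mono (integrable_actionGap hY hX) (integrable_const (maxGap θ X))
    fun w => actionGap_le_maxGap (hX w)).trans_eq ?_
  rw [integral_const, probReal_univ, one_smul]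

end ActionGap

variable (P : Measure Ω)

/-- The joint law of the internal randomness and the noise. -/
noncomputable abbrev BanditInstance.sampleLaw (J : BanditInstance d ι) :
    Measure (Ω × (ι × ℕ → ℝ)) :=
  P.prod (Measure.infinitePi fun _ : ι × ℕ => J.noise)

theorem BanditInstance.regret_eq_sum_integral_actionGap [IsProbabilityMeasure P]
    {J : BanditInstance d ι} (hJ : J.IsFixed X) {alg : MultiAlg d ι Ω} {i : ι}
    (hmeas : ∀ t, Measurable fun p : Ω × (ι × ℕ → ℝ) => alg p.1 (J.history alg p.1 p.2 t) i)
    (hmem : ∀ w H, alg w H i ∈ X) (T : ℕ) :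
    J.regret P alg T i = ∑ t ∈ Finset.range T,
      ∫ p, actionGap J.theta X (alg p.1 (J.history alg p.1 p.2 t) i) ∂J.sampleLaw P := by
  have := J.noise_prob
  refine Finset.sum_congr rfl fun t _ => ?_
  rw [integral_actionGap (hmeas t) fun p => hmem _ _, hJ i t]

variable (S : SingleAlg d X Ω) (ρ : RemovalRule d ι) (θ : Act d)

theorem SingleAlg.measurable_outcome :
    Measurable fun q : (Ω × List (Act d × ℝ)) × ℝ => S.outcome θ q.1.1 q.1.2 q.2 := by
  have hact : Measurable fun q : (Ω × List (Act d × ℝ)) × ℝ => S.act q.1.1 q.1.2 :=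
    (measurable_act_list S).comp measurable_fst
  exact hact.prodMk ((measurable_const.inner hact).add measurable_snd)

section Single

/-- The expected regret of the single-agent algorithm at its `j + 1`-st step. -/
noncomputable def SingleAlg.stepRegret (ν : Measure ℝ) (j : ℕ) : ℝ :=
  ∫ p, actionGap θ X (S.act p.1
      (adaptiveHist (S.outcome θ) (fun _ h => ((), h.length)) p.1 p.2 j))
    ∂P.prod (Measure.infinitePi fun _ : Unit × ℕ => ν)

variable {ν : Measure ℝ} [IsProbabilityMeasure ν]

section FreshIndex

variable {κ : Type*} [Countable κ] [MeasurableSpace κ] [MeasurableSingletonClass κ]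
  {idx : Ω → List (Act d × ℝ) → κ}

theorem IsFreshIndex.measurable_act_adaptiveHist (hidx : IsFreshIndex idx) (j : ℕ) :
    Measurable fun p : Ω × (κ → ℝ) => S.act p.1 (adaptiveHist (S.outcome θ) idx p.1 p.2 j) :=
  (measurable_act_list S).comp (measurable_fst.prodMk
    (measurable_adaptiveHist (S.measurable_outcome θ) hidx.measurable j))

theorem IsFreshIndex.integral_actionGap_act [SFinite P] (hidx : IsFreshIndex idx) (j : ℕ) :
    ∫ p, actionGap θ X (S.act p.1 (adaptiveHist (S.outcome θ) idx p.1 p.2 j))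
      ∂P.prod (Measure.infinitePi fun _ : κ => ν) = S.stepRegret P θ ν j := by
  have hgap : Measurable fun q : Ω × List (Act d × ℝ) => actionGap θ X (S.act q.1 q.2) :=
    (measurable_actionGap θ X).comp (measurable_act_list S)
  have hG := S.measurable_outcome θ
  have hfresh : IsFreshIndex fun (_ : Ω) (h : List (Act d × ℝ)) => ((), h.length) :=
    isFreshIndex_length ()
  rw [SingleAlg.stepRegret,
    ← integral_map (measurable_fst.prodMk
      (measurable_adaptiveHist hG hidx.measurable j)).aemeasurable hgap.aestronglyMeasurable,
    ← integral_map (measurable_fst.prodMk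
      (measurable_adaptiveHist hG hfresh.measurable j)).aemeasurable hgap.aestronglyMeasurable,
    map_adaptiveHist_eq_of_isFreshIndex hG hidx hfresh]

end FreshIndex

theorem SingleAlg.stepRegret_nonneg (ν : Measure ℝ) (j : ℕ) : 0 ≤ S.stepRegret P θ ν j :=
  integral_nonneg fun _ => actionGap_nonneg (S.act_mem _ _)

theorem SingleAlg.stepRegret_le_maxGap [IsProbabilityMeasure P] (j : ℕ) :
    S.stepRegret P θ ν j ≤ maxGap θ X :=
  integral_actionGap_le_maxGap
    (IsFreshIndex.measurable_act_adaptiveHist S θ (isFreshIndex_length ()) j)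
    fun _ => S.act_mem _ _

theorem BanditInstance.map_history_single (J : BanditInstance d ι) (i : ι) (w : Ω)
    (η : ι × ℕ → ℝ) (t : ℕ) :
    (J.history (fun w H _ => S.act w (H.map fun p => p i)) w η t).map (fun p => p i) =
      adaptiveHist (S.outcome J.theta) (fun _ h => (i, h.length)) w η t := by
  induction t with
  | zero => rfl
  | succ t ih =>
    simp only [history, List.map_append, ih, adaptiveHist, length_adaptiveHist]
    rfl

theorem BanditInstance.singleRegret_eq_sum_stepRegret {A : Type*} [IsProbabilityMeasure P]
    {I : BanditInstance d A} (hX : I.IsFixed X) (a : A) (N : ℕ) :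
    I.singleRegret P S a N = ∑ j ∈ Finset.range N, S.stepRegret P I.theta I.noise j := by
  let _ : MeasurableSpace ({a} : Finset A) := ⊤
  have : DiscreteMeasurableSpace ({a} : Finset A) := ⟨fun _ => trivial⟩
  set i : ({a} : Finset A) := ⟨a, Finset.mem_singleton_self a⟩
  set J := I.restrict {a}
  have := J.noise_prob
  have hfresh : IsFreshIndex fun (_ : Ω) (h : List (Act d × ℝ)) => (i, h.length) :=
    isFreshIndex_length i
  have hact (t : ℕ) : Measurable fun p : Ω × (({a} : Finset A) × ℕ → ℝ) => S.act p.1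
      ((J.history (fun w H _ => S.act w (H.map fun p => p i)) p.1 p.2 t).map fun p => p i) := by
    simpa only [J.map_history_single S i] using hfresh.measurable_act_adaptiveHist S J.theta t
  refine (J.regret_eq_sum_integral_actionGap P (fun b t => hX b t) hact
    (fun _ _ => S.act_mem _ _) N).trans (Finset.sum_congr rfl fun j _ => ?_)
  refine (integral_congr_ae (.of_forall fun p => ?_)).trans
    (hfresh.integral_actionGap_act P S J.theta j)
  exact congrArg (fun h => actionGap J.theta X (S.act p.1 h))
    (J.map_history_single S i p.1 p.2 j)

end Single

section Coalition

variable [Fintype ι] [Nonempty ι]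

/-- After the simulated history `h`, the meta-algorithm needs a new time-step. -/
def NeedsStep (w : Ω) (h : List (Act d × ℝ)) : Prop :=
  (buffers S ρ w h).avail (S.request w h) = ∅

variable {S ρ θ} {w : Ω} {η : ι × ℕ → ℝ}

theorem NeedsStep.time_lt {i j : ℕ} (hi : NeedsStep S ρ w (simulatedHist S ρ θ w η i))
    (hij : i < j) :
    (buffers S ρ w (simulatedHist S ρ θ w η i)).time <
      (buffers S ρ w (simulatedHist S ρ θ w η j)).time := by
  refine lt_of_lt_of_le ?_ (monotone_time_buffers S ρ w
    (adaptiveHist_isPrefix w η (Nat.succ_le_of_lt hij)))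
  rw [adaptiveHist, buffers_concat, BufState.advance, BufState.take, BufState.refill,
    if_neg (Finset.not_nonempty_iff_eq_empty.mpr hi)]
  exact Nat.lt_succ_self _

theorem NeedsStep.eq_of_time_eq {i j : ℕ} (hi : NeedsStep S ρ w (simulatedHist S ρ θ w η i))
    (hj : NeedsStep S ρ w (simulatedHist S ρ θ w η j))
    (htime : (buffers S ρ w (simulatedHist S ρ θ w η i)).time =
      (buffers S ρ w (simulatedHist S ρ θ w η j)).time) : i = j :=
  (lt_trichotomy i j).elim (fun h => absurd htime (hi.time_lt h).ne)
    (Or.elim · id fun h => absurd htime (hj.time_lt h).ne')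

variable (S ρ)

theorem BanditInstance.exists_mulAct_eq_act (J : BanditInstance d ι) (w : Ω) (η : ι × ℕ → ℝ)
    (t : ℕ) :
    ∃ j, ((buffers S ρ w (simulatedHist S ρ J.theta w η j)).time = t ∧
        NeedsStep S ρ w (simulatedHist S ρ J.theta w η j)) ∧
      J.mulAct S ρ w η t = S.act w (simulatedHist S ρ J.theta w η j) := by
  obtain ⟨j, hj, ht⟩ := J.exists_matches_mulState S ρ w η t
  exact ⟨j, ⟨ht, hj.avail_next.symm.trans (J.mulState_avail_mulAct S ρ w η t)⟩, hj.next_eq⟩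

theorem BanditInstance.measurable_mulAct (J : BanditInstance d ι) (t : ℕ) :
    Measurable fun p : Ω × (ι × ℕ → ℝ) => J.mulAct S ρ p.1 p.2 t := by
  classical
  let _ : MeasurableSpace ι := ⊤
  have : DiscreteMeasurableSpace ι := ⟨fun _ => trivial⟩
  have hact := (isFreshIndex_bufferIdx S ρ).measurable_act_adaptiveHist S J.theta
  have hhist (j : ℕ) : Measurable fun p : Ω × (ι × ℕ → ℝ) =>
      (p.1, simulatedHist S ρ J.theta p.1 p.2 j) :=
    measurable_fst.prodMk
      (measurable_adaptiveHist (S.measurable_outcome _) (measurable_bufferIdx S ρ) j)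
  have hstep (j : ℕ) : MeasurableSet {p : Ω × (ι × ℕ → ℝ) |
      (buffers S ρ p.1 (simulatedHist S ρ J.theta p.1 p.2 j)).time = t ∧
        NeedsStep S ρ p.1 (simulatedHist S ρ J.theta p.1 p.2 j)} :=
    (((measurable_buffers S ρ).prodMk (measurable_request S)).comp (hhist j))
      (MeasurableSet.of_discrete (s := {q : BufState X ι × X | q.1.time = t ∧ q.1.avail q.2 = ∅}))
  have hex (p : Ω × (ι × ℕ → ℝ)) := (J.exists_mulAct_eq_act S ρ p.1 p.2 t).imp fun _ h => h.1
  convert Measurable.find hact hstep hex using 2 with p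
  obtain ⟨j, ⟨htime, hneeds⟩, heq⟩ := J.exists_mulAct_eq_act S ρ p.1 p.2 t
  obtain ⟨htime', hneeds'⟩ := Nat.find_spec (hex p)
  rw [heq, hneeds.eq_of_time_eq hneeds' (htime.trans htime'.symm)]

theorem BanditInstance.exists_card_mul_sum_mulAct_eq (J : BanditInstance d ι) (w : Ω)
    (η : ι × ℕ → ℝ) (T : ℕ) :
    ∃ j, ∀ g : Act d → ℝ, Fintype.card ι * ∑ t ∈ Finset.range T, g (J.mulAct S ρ w η t) =
      ∑ i ∈ Finset.range j, g (S.act w (simulatedHist S ρ J.theta w η i)) +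
        ∑ x ∈ X, (((J.mulState S ρ w η T).avail x).card : ℝ) * g x := by
  obtain ⟨j, hj, -⟩ := J.exists_matches_mulState S ρ w η T
  have hsum (g : Act d → ℝ) (i : ℕ) :
      ((simulatedHist S ρ J.theta w η i).map fun q => g q.1).sum =
        ∑ k ∈ Finset.range i, g (S.act w (simulatedHist S ρ J.theta w η k)) := by
    induction i with
    | zero => rfl
    | succ i ih =>
      rw [simulatedHist, adaptiveHist, List.map_append, List.sum_append, ih, Finset.sum_range_succ]
      simp [SingleAlg.outcome]
  exact ⟨j, fun g => by rw [← J.weight_mulState S ρ w η T g, MulState.weight, hj.hist, hsum]⟩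

/-- The plays of the meta-algorithm and equally many plays of the simulated algorithm differ only
by the plays whose rewards are in the buffers. -/
theorem BanditInstance.abs_sum_mulAct_sub_le (J : BanditInstance d ι) (w : Ω) (η : ι × ℕ → ℝ)
    (T : ℕ) {g : Act d → ℝ} {B : ℝ} (hg₀ : ∀ x ∈ X, 0 ≤ g x) (hgB : ∀ x ∈ X, g x ≤ B) :
    |Fintype.card ι * ∑ t ∈ Finset.range T, g (J.mulAct S ρ w η t) -
      ∑ i ∈ Finset.range (Fintype.card ι * T), g (S.act w (simulatedHist S ρ J.theta w η i))| ≤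
        ((Fintype.card ι : ℝ) - 1) * X.card * B := by
  obtain ⟨j, hj⟩ := J.exists_card_mul_sum_mulAct_eq S ρ w η T
  set b := ∑ x ∈ X, ((J.mulState S ρ w η T).avail x).card
  have hcount : Fintype.card ι * T = j + b := by
    have := hj fun _ => 1
    simp only [Finset.sum_const, Finset.card_range, nsmul_eq_mul, mul_one] at this
    exact_mod_cast this
  have hB : 0 ≤ B := (hg₀ _ (S.act_mem w [])).trans (hgB _ (S.act_mem w []))
  have hb : b * B ≤ ((Fintype.card ι : ℝ) - 1) * X.card * B := by
    refine mul_le_mul_of_nonneg_right ?_ hB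
    have hcard (x : Act d) (_ : x ∈ X) :
        ((J.mulState S ρ w η T).avail x).card ≤ Fintype.card ι - 1 :=
      Nat.le_sub_one_of_lt (J.card_avail_mulState_lt S ρ w η T x)
    have := Finset.sum_le_card_nsmul X _ _ hcard
    rw [← Nat.cast_pred Fintype.card_pos, mul_comm]
    exact_mod_cast this
  rw [hj, hcount, Finset.sum_range_add, add_sub_add_left_eq_sub]
  refine (abs_sub_le_of_nonneg_of_le ?_ ?_ ?_ ?_).trans hb
  · exact Finset.sum_nonneg fun x hx => mul_nonneg (Nat.cast_nonneg _) (hg₀ x hx)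
  · rw [Nat.cast_sum, Finset.sum_mul]
    exact Finset.sum_le_sum fun x hx => mul_le_mul_of_nonneg_left (hgB x hx) (Nat.cast_nonneg _)
  · exact Finset.sum_nonneg fun i _ => hg₀ _ (S.act_mem _ _)
  · exact (Finset.sum_le_card_nsmul _ _ B fun i _ => hgB _ (S.act_mem _ _)).trans_eq (by simp)

variable [IsProbabilityMeasure P]

theorem BanditInstance.abs_sum_integral_mulAct_sub_le (J : BanditInstance d ι) (T : ℕ) :
    |Fintype.card ι * ∑ t ∈ Finset.range T,
        ∫ p, actionGap J.theta X (J.mulAct S ρ p.1 p.2 t) ∂J.sampleLaw P -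
      ∑ j ∈ Finset.range (Fintype.card ι * T), S.stepRegret P J.theta J.noise j| ≤
        ((Fintype.card ι : ℝ) - 1) * X.card * maxGap J.theta X := by
  have := J.noise_prob
  let _ : MeasurableSpace ι := ⊤
  have : DiscreteMeasurableSpace ι := ⟨fun _ => trivial⟩
  have hfresh := isFreshIndex_bufferIdx S ρ
  have hmul (t : ℕ) : Integrable
      (fun p => actionGap J.theta X (J.mulAct S ρ p.1 p.2 t)) (J.sampleLaw P) :=
    integrable_actionGap (J.measurable_mulAct S ρ t) fun p => S.act_mem _ _
  have hsim (j : ℕ) : Integrable (fun p => actionGap J.theta X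
      (S.act p.1 (simulatedHist S ρ J.theta p.1 p.2 j))) (J.sampleLaw P) :=
    integrable_actionGap (hfresh.measurable_act_adaptiveHist S J.theta j) fun p => S.act_mem _ _
  simp only [← hfresh.integral_actionGap_act P S J.theta]
  rw [← integral_finsetSum _ fun t _ => hmul t, ← integral_finsetSum _ fun j _ => hsim j,
    ← integral_const_mul, ← integral_sub ((integrable_finsetSum _ fun t _ => hmul t).const_mul _)
      (integrable_finsetSum _ fun j _ => hsim j)]
  have hbound := norm_integral_le_of_norm_le_const (μ := J.sampleLaw P) (.of_forall fun p =>
    (Real.norm_eq_abs _).trans_le (J.abs_sum_mulAct_sub_le S ρ p.1 p.2 T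
      (fun _ => actionGap_nonneg (θ := J.theta)) fun _ => actionGap_le_maxGap))
  rwa [probReal_univ, mul_one, Real.norm_eq_abs] at hbound

end Coalition

end Regret

section Value

variable {d : ℕ} {A Ω : Type*} {X : Finset (Act d)} [MeasurableSpace Ω]
  (P : Measure Ω) {I : BanditInstance d A}

theorem BanditInstance.value_mul_empty (S : SingleAlg d X Ω)
    (ρ : ∀ C : Finset A, RemovalRule d C) (T : ℕ) :
    I.value P (fun C => mul S (ρ C)) T ∅ = 0 := by
  rw [value, Finset.univ_eq_empty, Finset.sum_empty, neg_zero]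

variable [IsProbabilityMeasure P] (S : SingleAlg d X Ω)
  (ρ : ∀ C : Finset A, RemovalRule d C)

theorem BanditInstance.value_mul_eq (hX : I.IsFixed X) (T : ℕ) {C : Finset A} [Nonempty C] :
    I.value P (fun C => mul S (ρ C)) T C =
      -(C.card * ∑ t ∈ Finset.range T,
        ∫ p, actionGap I.theta X ((I.restrict C).mulAct S (ρ C) p.1 p.2 t)
          ∂(I.restrict C).sampleLaw P) := by
  have hregret (a : C) : (I.restrict C).regret P (mul S (ρ C)) T a = ∑ t ∈ Finset.range T,
      ∫ p, actionGap I.theta X ((I.restrict C).mulAct S (ρ C) p.1 p.2 t)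
        ∂(I.restrict C).sampleLaw P :=
    (I.restrict C).regret_eq_sum_integral_actionGap P (fun b t => hX b t)
      ((I.restrict C).measurable_mulAct S (ρ C)) (fun _ _ => S.act_mem _ _) T
  rw [value, Finset.sum_congr rfl fun a _ => hregret a, Finset.sum_const, Finset.card_univ,
    Fintype.card_coe, nsmul_eq_mul]

theorem BanditInstance.abs_value_mul_add_singleRegret_le (hX : I.IsFixed X) (a : A) (T : ℕ)
    {C : Finset A} (hC : C.Nonempty) :
    |I.value P (fun C => mul S (ρ C)) T C + I.singleRegret P S a (C.card * T)| ≤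
      ((C.card : ℝ) - 1) * X.card * maxGap I.theta X := by
  have := hC.to_subtype
  have hbound := (I.restrict C).abs_sum_integral_mulAct_sub_le P S (ρ C) T
  rw [Fintype.card_coe] at hbound
  rw [value_mul_eq P S ρ hX T, singleRegret_eq_sum_stepRegret P S hX a, neg_add_eq_sub,
    abs_sub_comm]
  exact hbound

theorem BanditInstance.value_mul_one (hX : I.IsFixed X) (C : Finset A) :
    I.value P (fun C => mul S (ρ C)) 1 C =
      -(C.card * ∫ w, actionGap I.theta X (S.act w []) ∂P) := by
  rcases C.eq_empty_or_nonempty with rfl | hC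
  · rw [value_mul_empty, Finset.card_empty, Nat.cast_zero, zero_mul, neg_zero]
  · have := hC.to_subtype
    have := (I.restrict C).noise_prob
    rw [value_mul_eq P S ρ hX 1, Finset.sum_range_one]
    refine congrArg (fun z => -((C.card : ℝ) * z))
      ((integral_fun_fst fun w => actionGap I.theta X (S.act w [])).trans ?_)
    rw [probReal_univ, one_smul]

end Value

section Convexity

/-- Concavity of `R` on the times `1, …, N` with margins `u t`, of either sign: the condition
`RegretRate.strict_concave` by itself. -/
def HasConcavityMargin (R : ℕ → ℝ) (N : ℕ) (u : ℕ → ℝ) : Prop :=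
  ∀ t g h, 1 ≤ t → 1 ≤ g → 1 ≤ h → t + g + h ≤ N → discDeriv2 R t g h ≤ -u t

variable {R u : ℕ → ℝ} {B : ℝ}

theorem HasConcavityMargin.increment_le {N t g h : ℕ} (H : HasConcavityMargin R N u) (ht : 1 ≤ t)
    (hg : 1 ≤ g) (hh : 1 ≤ h) (hN : t + g + h ≤ N) :
    R (t + g + h) - R (t + g) + u t * g * h ≤ R (t + h) - R t := by
  have hconc := H t g h ht hg hh hN
  rw [discDeriv2, discDeriv, discDeriv, div_le_iff₀ (by exact_mod_cast hg), ← sub_div,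
    div_le_iff₀ (by exact_mod_cast hh)] at hconc
  linarith

section Blocks

variable {m q T : ℕ}

theorem HasConcavityMargin.block_increment_le {s : ℕ} (H : HasConcavityMargin R (m * T) u)
    (hu : ∀ t, 1 ≤ t → t ≤ m * T → 4 * m * B ≤ u t * T ^ 2) (hB : 0 ≤ B) (hT : 1 ≤ T)
    (hs : 1 ≤ s) (hsq : s < q) (hq : q + 1 ≤ m) :
    R ((q + 1) * T) - R (q * T) + 4 * m * B ≤ R ((s + 1) * T) - R (s * T) := by
  obtain ⟨k, rfl⟩ := Nat.exists_eq_add_of_lt hsq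
  have hsT : 1 ≤ s * T := Nat.mul_pos hs hT
  have hend : s * T + (k + 1) * T + T ≤ m * T :=
    (by ring : _ = (s + k + 1 + 1) * T).trans_le (Nat.mul_le_mul_right T hq)
  have hconc := H.increment_le hsT (Nat.mul_pos k.succ_pos hT) hT hend
  have hmargin : 4 * m * B ≤ u (s * T) * ((k + 1) * T : ℕ) * T :=
    calc 4 * m * B ≤ (k + 1) * (4 * m * B) :=
          le_mul_of_one_le_left (by positivity) (by linarith [k.cast_nonneg (α := ℝ)])
      _ ≤ (k + 1) * (u (s * T) * T ^ 2) :=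
          mul_le_mul_of_nonneg_left (hu _ hsT (by omega)) (by positivity)
      _ = u (s * T) * ((k + 1) * T : ℕ) * T := by push_cast; ring
  have hstart : s * T + (k + 1) * T = (s + k + 1) * T := by ring
  rw [hstart, ← Nat.succ_mul, ← Nat.succ_mul] at hconc
  linarith

/-- The margins say nothing about time `0`, so the first block is taken without its first step. -/
theorem HasConcavityMargin.first_block_increment_le (H : HasConcavityMargin R (m * T) u)
    (hu : ∀ t, 1 ≤ t → t ≤ m * T → 4 * m * B ≤ u t * T ^ 2) (hB : 0 ≤ B) (hT : 2 ≤ T)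
    (hq : 1 ≤ q) (hqm : q + 1 ≤ m) :
    R ((q + 1) * T) - R (q * T + 1) + 2 * q * B ≤ R T - R 1 := by
  obtain ⟨k, rfl⟩ := Nat.exists_eq_add_of_le' (one_le_two.trans hT)
  have hk : (1 : ℝ) ≤ k := by exact_mod_cast Nat.le_of_succ_le_succ hT
  have hend : 1 + q * (k + 1) + k = (q + 1) * (k + 1) := by ring
  have hle : (q + 1) * (k + 1) ≤ m * (k + 1) := Nat.mul_le_mul_right _ hqm
  have hconc := H.increment_le le_rfl (Nat.mul_pos hq k.succ_pos) (Nat.le_of_succ_le_succ hT)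
    (hend.trans_le hle)
  have hu₁ := hu 1 le_rfl (by omega)
  have hm : (1 : ℝ) ≤ m := by exact_mod_cast (by omega : 1 ≤ m)
  have hBm : 4 * B ≤ 4 * m * B := mul_le_mul_of_nonneg_right (by linarith) hB
  have hu₀ : 0 ≤ u 1 :=
    nonneg_of_mul_nonneg_left (by linarith) (by positivity : 0 < ((k + 1 : ℕ) : ℝ) ^ 2)
  have hsq : ((k + 1 : ℕ) : ℝ) ^ 2 ≤ 2 * ((k + 1) * k) := by push_cast; nlinarith
  have hmargin : 2 * q * B ≤ u 1 * (q * (k + 1) : ℕ) * k := by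
    have := mul_le_mul_of_nonneg_left hsq hu₀
    calc 2 * q * B = q * (2 * B) := by ring
      _ ≤ q * (u 1 * ((k + 1) * k)) := mul_le_mul_of_nonneg_left (by linarith) q.cast_nonneg
      _ = u 1 * (q * (k + 1) : ℕ) * k := by push_cast; ring
  rw [hend, Nat.succ_eq_add_one, add_comm 1 (q * _), add_comm 1 k] at hconc
  linarith

end Blocks

/-- Up to `(2 * n - 1) * B`, hence within what the margin pays for, the marginal contribution of a
player to a coalition of `n ≥ 1` members is minus the increment of `R` from `n * T` to
`(n + 1) * T`. -/
theorem isConvexGame_of_hasConcavityMargin {A : Type*} [Fintype A] [DecidableEq A]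
    {v : Finset A → ℝ} {T : ℕ} (hT : 2 ≤ T) (hB : 0 ≤ B) (hR₁ : 0 ≤ R 1)
    (hstep : ∀ N, R (N + 1) ≤ R N + B) (hv₀ : v ∅ = 0)
    (hv : ∀ C : Finset A, C.Nonempty → |v C + R (C.card * T)| ≤ ((C.card : ℝ) - 1) * B)
    (H : HasConcavityMargin R (Fintype.card A * T) u)
    (hu : ∀ t, 1 ≤ t → t ≤ Fintype.card A * T → 4 * Fintype.card A * B ≤ u t * T ^ 2) :
    IsConvexGame v := by
  intro i C D hCD hiD
  rcases hCD.eq_or_ssubset with rfl | hss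
  · exact le_rfl
  have hlt := Finset.card_lt_card hss
  have hD : 0 < D.card := hlt.pos
  have hDA : D.card + 1 ≤ Fintype.card A :=
    (Finset.card_insert_of_notMem hiD).symm.trans_le (Finset.card_le_univ _)
  have hvCi := abs_le.mp (hv (insert i C) (Finset.insert_nonempty i C))
  have hvDi := abs_le.mp (hv (insert i D) (Finset.insert_nonempty i D))
  have hvD := abs_le.mp (hv D (Finset.card_pos.mp hD))
  rw [Finset.card_insert_of_notMem fun h => hiD (hCD h), Nat.cast_succ] at hvCi
  rw [Finset.card_insert_of_notMem hiD, Nat.cast_succ] at hvDi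
  rcases C.eq_empty_or_nonempty with rfl | hC
  · have hblock := H.first_block_increment_le hu hB hT hD hDA
    have hfirst := hstep (D.card * T)
    rw [Finset.card_empty, Nat.cast_zero, zero_add, zero_add, one_mul] at hvCi
    linarith [hvCi.2, hvDi.1, hvD.2]
  · have hblock := H.block_increment_le hu hB (one_le_two.trans hT) hC.card_pos hlt hDA
    have hvC := abs_le.mp (hv C hC)
    have hcard : (C.card : ℝ) + D.card ≤ 2 * Fintype.card A := by
      exact_mod_cast (by omega : C.card + D.card ≤ 2 * Fintype.card A)
    linarith [hvCi.2, hvDi.1, hvD.2, hvC.1, mul_le_mul_of_nonneg_right hcard hB]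

end Convexity

section Main

variable {d : ℕ} {A Ω : Type*} [Fintype A] [DecidableEq A] [MeasurableSpace Ω] (P : Measure Ω)
  [IsProbabilityMeasure P]

theorem mainTheorem1_general (I : BanditInstance d A) (X : Finset (Act d)) (hX : I.IsFixed X)
    (S : SingleAlg d X Ω) (ρ : ∀ C : Finset A, RemovalRule d C) (a : A) (T : ℕ) (u : ℕ → ℝ)
    (hconc : HasConcavityMargin (I.singleRegret P S a) (Fintype.card A * T) u)
    (hu : ∀ t, 1 ≤ t → t ≤ Fintype.card A * T →
      4 * Fintype.card A * X.card * maxGap I.theta X ≤ u t * T ^ 2) :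
    IsConvexGame (I.value P (fun C => mul S (ρ C)) T) := by
  have := I.noise_prob
  have hXne : X.Nonempty := (nonempty_of_isProbabilityMeasure P).elim fun w => ⟨_, S.act_mem w []⟩
  have hgap : 0 ≤ maxGap I.theta X := maxGap_nonneg _ _
  have hgapB : maxGap I.theta X ≤ X.card * maxGap I.theta X :=
    le_mul_of_one_le_left hgap (by exact_mod_cast hXne.card_pos)
  have hR := I.singleRegret_eq_sum_stepRegret P S hX a
  match T with
  | 0 =>
    intro i C D _ _
    simp only [BanditInstance.value, BanditInstance.regret, Finset.range_zero, Finset.sum_empty,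
      Finset.sum_const_zero, le_refl]
  | 1 =>
    intro i C D hCD hiD
    simp only [I.value_mul_one P S ρ hX, Finset.card_insert_of_notMem hiD,
      Finset.card_insert_of_notMem fun h => hiD (hCD h), Nat.cast_succ]
    linarith
  | T + 2 =>
    simp only [mul_assoc _ (X.card : ℝ)] at hu
    refine isConvexGame_of_hasConcavityMargin (by omega) (hgap.trans hgapB) ?_ (fun N => ?_)
      (I.value_mul_empty P S ρ _) (fun C hC => ?_) hconc hu
    · rw [hR, Finset.sum_range_one]
      exact S.stepRegret_nonneg P _ _ 0
    · rw [hR, hR, Finset.sum_range_succ]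
      gcongr
      exact (S.stepRegret_le_maxGap P _ N).trans hgapB
    · rw [← mul_assoc]
      exact I.abs_value_mul_add_singleRegret_le P S ρ hX a _ hC

end Main

theorem le_mul_rpow_mul_sq_of_rpow_le {b c m T ε : ℝ} (hb : 0 ≤ b) (hc : 0 < c) (hm : 0 < m)
    (hT : 0 < T) (hε : 0 < ε) (h : (b * m ^ (3 - ε) / c) ^ (1 / ε) ≤ T) :
    m * b ≤ c * (m * T) ^ (-2 + ε) * T ^ 2 := by
  rw [one_div, Real.rpow_inv_le_iff_of_pos (by positivity) hT.le hε, div_le_iff₀ hc] at h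
  have hmpow : m ^ (3 - ε) * m ^ (-2 + ε) = m := by
    rw [← Real.rpow_add hm, show 3 - ε + (-2 + ε) = 1 by ring, Real.rpow_one]
  have hTpow : T ^ (-2 + ε) * T ^ 2 = T ^ ε := by
    rw [← Real.rpow_add_natCast hT.ne', Nat.cast_ofNat, neg_add_cancel_comm]
  calc m * b = b * m ^ (3 - ε) * m ^ (-2 + ε) := by rw [mul_assoc, hmpow, mul_comm]
    _ ≤ T ^ ε * c * m ^ (-2 + ε) := by gcongr
    _ = c * (m * T) ^ (-2 + ε) * T ^ 2 := by
      rw [← hTpow, Real.mul_rpow hm.le hT.le]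
      ring

theorem mainTheorem1 {d : ℕ} {A : Type*} [Fintype A] [DecidableEq A]
    {Ω : Type*} [MeasurableSpace Ω] (P : Measure Ω) [IsProbabilityMeasure P]
    (I : BanditInstance d A) (X : Finset (Act d)) (hX : I.IsFixed X)
    (S : SingleAlg d X Ω) (ρ : ∀ C : Finset A, RemovalRule d C) (a : A) :
    (∀ (T : ℕ) (υ : ℕ → ℝ) (c ε : ℝ), 0 < c → 0 < ε →
      RegretRate (I.singleRegret P S a) (Fintype.card A * T) υ c ε →
      (∀ t, 1 ≤ t → t ≤ Fintype.card A * T →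
        Real.sqrt (4 * Fintype.card A * X.card * maxGap I.theta X / υ t) ≤ T) →
      IsConvexGame (I.value P (fun C => mul S (ρ C)) T)) ∧
    (∀ c ε : ℝ, 0 < c → 0 < ε → ε < 2 →
      (∀ t g h : ℕ, 1 ≤ t → 1 ≤ g → 1 ≤ h →
        discDeriv2 (I.singleRegret P S a) t g h ≤ -(c * ((t + g + h : ℕ) : ℝ) ^ (-2 + ε))) →
      ∀ T : ℕ,
        (4 * X.card * maxGap I.theta X * (Fintype.card A : ℝ) ^ (3 - ε) / c) ^ (1 / ε) ≤ T →
        IsConvexGame (I.value P (fun C => mul S (ρ C)) T)) := by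
  refine ⟨fun T υ c ε _ _ hR hT => ?_, fun c ε hc hε hε₂ hR T hT => ?_⟩
  · refine mainTheorem1_general P I X hX S ρ a T υ hR.strict_concave fun t ht htN => ?_
    rw [mul_comm (υ t), ← div_le_iff₀ (hR.margin_pos t ht htN)]
    exact (Real.sqrt_le_left T.cast_nonneg).mp (hT t ht htN)
  · refine mainTheorem1_general P I X hX S ρ a T
      (fun _ => c * (Fintype.card A * T : ℝ) ^ (-2 + ε))
      (fun t g h ht hg hh hN => (hR t g h ht hg hh).trans ?_) fun t ht htN => ?_
    · have hpow := Real.rpow_le_rpow_of_nonpos (by positivity) (Nat.cast_le (α := ℝ).mpr hN)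
        (by linarith : -2 + ε ≤ 0)
      rw [Nat.cast_mul] at hpow
      exact neg_le_neg (mul_le_mul_of_nonneg_left hpow hc.le)
    · have hpos : 0 < Fintype.card A * T := ht.trans htN
      have hgap := maxGap_nonneg I.theta X
      have hmargin := le_mul_rpow_mul_sq_of_rpow_le (by positivity) hc
        (by exact_mod_cast Nat.pos_of_mul_pos_right hpos)
        (by exact_mod_cast Nat.pos_of_mul_pos_left hpos) hε hT
      linarith
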